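/- Consider a finite zero-sum stochastic game with state set $K=\{1,\dots,n\}$, $n\ge 1$, finite non-empty action sets $I^\ell$ and $J^\ell$ of Players 1 and 2 at each state $\ell\in K$, payoff function $g$ and transition function $q$, where $g(\ell,i,j)\in\mathbb R$ and $q(\cdot\mid \ell,i,j)$ is a probability on $K$ for all $\ell\in K$ and $(i,j)\in I^\ell\times J^\ell$. Assume that there is an integer $N\ge 1$ such that $$g(\ell,i,j),\ q(\ell'\mid \ell,i,j)\in\{0,\tfrac1N,\tfrac2N,\dots,1\}\qquad\text{for all }\ell,\ell'\in K,\ (i,j)\in I^\ell\times J^\ell .$$ Let $|I|=\prod_{\ell=1}^n|I^\ell|$ be the number of pure stationary strategies of Player 1, and for $p\in\mathbb N$ let $\mathsf{bit}(p)=\lceil\log_2(p+1)\rceil$; the bit-size of an integer $a$ is $\mathsf{bit}(|a|)$. For $\lambda\in(0,1]$ and an initial state $k$, let $$v^k_\lambda=\sup_\sigma\inf_\tau\ \mathbb E^k_{\sigma,\tau}\Big[\sum_{m\ge1}\lambda(1-\lambda)^{m-1}g(k_m,i_m,j_m)\Big]$$ be the value of the $\lambda$-discounted game, where $\sigma$ and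 $\tau$ range over all strategies of Players 1 and 2, which choose at every stage a probability on the actions available at the current state as a function of all past states and actions and of the current state. Then for every $k\in K$ the limit $w^k=\lim_{\lambda\to0^+}v^k_\lambda$ exists and is an algebraic number. It has a unique defining polynomial, that is, a polynomial $P(z)=a_0+a_1z+\dots+a_pz^p$ with integer coefficients, of the least degree among the non-zero integer polynomials vanishing at $w^k$, with $P(w^k)=0$, $a_p>0$ and $\gcd(a_0,\dots,a_p)=1$. Every coefficient of this polynomial has bit-size at most $$C=8\,|I|^2\,n^2\,\mathsf{bit}(N).$$ -/

import Mathlib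

open Filter Topology MeasureTheory ProbabilityTheory Polynomial

noncomputable section

/-- A finite zero-sum stochastic game with state set `{1, …, n}` (here `Fin n`), action sets
`I ℓ` and `J ℓ` of the two players at state `ℓ`, payoff function `g` and transition function `q`.
The set `Δ(E)` of probabilities over a finite set `E` is `PMF E`. -/
structure StochasticGame (n : ℕ) (I J : Fin n → Type*) where
  g : (ℓ : Fin n) → I ℓ → J ℓ → ℝ
  q : (ℓ : Fin n) → I ℓ → J ℓ → PMF (Fin n)

namespace StochasticGame

variable {n : ℕ} {I J : Fin n → Type*}

/-- The set `Z` of triples (state, action of Player 1, action of Player 2). -/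
def Obs (I J : Fin n → Type*) : Type _ := Σ ℓ : Fin n, I ℓ × J ℓ

instance [∀ ℓ, Finite (I ℓ)] [∀ ℓ, Finite (J ℓ)] : Finite (Obs I J) :=
  inferInstanceAs (Finite (Σ ℓ : Fin n, I ℓ × J ℓ))

instance : MeasurableSpace (Obs I J) := ⊤

instance : DiscreteMeasurableSpace (Obs I J) := ⟨fun _ => trivial⟩

/-- Strategies of a player with action sets `A ℓ`: the mixed action `σ m h ℓ` is used when the
`m` past observations are `h` and the current state is `ℓ`. -/
def Strategy (I J : Fin n → Type*) (A : Fin n → Type*) : Type _ :=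
  (m : ℕ) → (Fin m → Obs I J) → (ℓ : Fin n) → PMF (A ℓ)

/-- The law of (state, action 1, action 2) when the state has law `p` and, given the state, the
actions are drawn independently from the mixed actions `x` and `y` at that state. -/
def obsLaw (p : PMF (Fin n)) (x : (ℓ : Fin n) → PMF (I ℓ)) (y : (ℓ : Fin n) → PMF (J ℓ)) :
    PMF (Obs I J) :=
  p.bind fun ℓ => (x ℓ).bind fun i => (y ℓ).map fun j => ⟨ℓ, i, j⟩

/-- The transition kernel of the play: the conditional law of the observation of index `m + 1`
given the observations of index `0, …, m`. -/
def stepKernel [∀ ℓ, Finite (I ℓ)] [∀ ℓ, Finite (J ℓ)] (G : StochasticGame n I J)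
    (σ : Strategy I J I) (τ : Strategy I J J) (m : ℕ) :
    Kernel ((_ : Finset.Iic m) → Obs I J) (Obs I J) :=
  Kernel.ofFunOfCountable fun h =>
    let last : Obs I J := h ⟨m, Finset.mem_Iic.2 le_rfl⟩
    let past : Fin (m + 1) → Obs I J :=
      fun r => h ⟨r, Finset.mem_Iic.2 (Nat.lt_succ_iff.1 r.isLt)⟩
    (obsLaw (G.q last.1 last.2.1 last.2.2) (σ (m + 1) past) (τ (m + 1) past)).toMeasure

instance [∀ ℓ, Finite (I ℓ)] [∀ ℓ, Finite (J ℓ)] (G : StochasticGame n I J)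
    (σ : Strategy I J I) (τ : Strategy I J J) (m : ℕ) :
    IsMarkovKernel (G.stepKernel σ τ m) :=
  ⟨fun _ => PMF.toMeasure.isProbabilityMeasure _⟩

/-- The probability on plays `Z^ℕ` induced by the initial state `k` and strategies `σ`, `τ`
(stages are indexed from `0`). -/
def playLaw [∀ ℓ, Finite (I ℓ)] [∀ ℓ, Finite (J ℓ)] (G : StochasticGame n I J) (k : Fin n)
    (σ : Strategy I J I) (τ : Strategy I J J) : Measure (ℕ → Obs I J) :=
  Kernel.trajMeasure (X := fun _ => Obs I J)
    (obsLaw (PMF.pure k) (σ 0 Fin.elim0) (τ 0 Fin.elim0)).toMeasure (G.stepKernel σ τ)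

/-- The expected `lam`-discounted payoff
`E [∑_{m ≥ 1} lam (1 - lam) ^ (m - 1) g(k_m, i_m, j_m)]`. -/
def payoff [∀ ℓ, Finite (I ℓ)] [∀ ℓ, Finite (J ℓ)] (G : StochasticGame n I J) (lam : ℝ)
    (k : Fin n) (σ : Strategy I J I) (τ : Strategy I J J) : ℝ :=
  ∫ z, (∑' m : ℕ, lam * (1 - lam) ^ m * G.g (z m).1 (z m).2.1 (z m).2.2) ∂(G.playLaw k σ τ)

/-- The value `v^k_lam` of the `lam`-discounted game with initial state `k`. -/
def value [∀ ℓ, Finite (I ℓ)] [∀ ℓ, Finite (J ℓ)] (G : StochasticGame n I J) (lam : ℝ)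
    (k : Fin n) : ℝ :=
  ⨆ σ : Strategy I J I, ⨅ τ : Strategy I J J, G.payoff lam k σ τ

/-- All payoffs and transition probabilities lie in `{0, 1/N, 2/N, …, 1}`. -/
def IsRationalWith (G : StochasticGame n I J) (N : ℕ) : Prop :=
  0 < N ∧ ∀ (ℓ : Fin n) (i : I ℓ) (j : J ℓ),
    (∃ m : ℕ, m ≤ N ∧ G.g ℓ i j = m / N) ∧
    ∀ ℓ' : Fin n, ∃ m : ℕ, m ≤ N ∧ (G.q ℓ i j ℓ').toReal = m / N

end StochasticGame

/-- The bit-size `⌈log₂ (p + 1)⌉` of a natural number. -/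
def bitSize (p : ℕ) : ℕ := ⌈Real.logb 2 ((p : ℝ) + 1)⌉₊

/-- `P` is the defining polynomial of the algebraic number `α`: an integer polynomial vanishing
at `α`, of the least possible degree among the nonzero ones (the degree of `α`), with positive
leading coefficient and coprime coefficients. -/
def IsDefiningPolynomial (P : ℤ[X]) (α : ℝ) : Prop :=
  aeval α P = 0 ∧ 0 < P.leadingCoeff ∧ P.IsPrimitive ∧
    ∀ Q : ℤ[X], Q ≠ 0 → aeval α Q = 0 → P.natDegree ≤ Q.natDegree

end

/-! For fixed λ, the Shapley equation has a solution `v`, and stationary strategies optimal in the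
local games show that it is the discounted value. By Cramer's rule the payoff of a pure stationary
profile is a ratio of two determinants, polynomial in λ, with positive denominator. These
determinants are multilinear in their rows, and the row of a state depends only on the actions at
that state. Hence the products over states of the local optimal mixed actions are optimal in the
matrix game `num - z den` on pure stationary strategies, which has value zero at `z = v k`
(`IsShapleySolution.exists_nonneg_vecMul`, `IsShapleySolution.exists_mulVec_nonpos`). A Shapley–Snow
kernel argument (`Matrix.exists_submatrix_det_eq_zero`) then gives a square submatrix whose
determinant vanishes at `z = v k` but not for all `z`; the latter forces distinct rows, hence size
at most |I|.

After scaling by powers of N, these determinants form a finite family of integer polynomials in (λ,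
z), the same for all λ. Removing the largest power of λ and letting λ tend to 0 leaves the lowest
λ-coefficient, a nonzero integer polynomial in z that vanishes at every limit point along the curve.
Its finitely many roots and the continuity of the value in λ exclude oscillation, so the limit
exists and is algebraic (`exists_tendsto_of_aevalAeval_eq_zero`).

That coefficient has degree at most |I|, and its coefficients have a bounded sum of absolute values,
since this sum is submultiplicative. The defining polynomial divides it, and Mahler's measure turns
divisibility into a bound on coefficients (`IsDefiningPolynomial.abs_coeff_le`). -/

/-! ### Matrix games and the minimax theorem -/

section MatrixGame

open Matrix

variable {I J : Type*} [Fintype I] [Fintype J]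

/-- **Ville's alternative**. -/
theorem exists_stdSimplex_vecMul_nonneg_or_mulVec_neg [Nonempty I] [Nonempty J]
    (M : Matrix I J ℝ) :
    (∃ x ∈ stdSimplex ℝ I, ∀ j, 0 ≤ (x ᵥ* M) j) ∨ ∃ y ∈ stdSimplex ℝ J, ∀ i, (M *ᵥ y) i < 0 := by
  classical
  by_cases h : ∃ y ∈ stdSimplex ℝ J, ∀ i, (M *ᵥ y) i < 0
  · exact Or.inr h
  left
  push Not at h
  have hconv : Convex ℝ {w : I → ℝ | ∀ i, w i < 0} := by
    have : {w : I → ℝ | ∀ i, w i < 0} = Set.univ.pi fun _ => Set.Iio 0 := by ext; simp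
    rw [this]
    exact convex_pi fun _ _ => convex_Iio 0
  have hopen : IsOpen {w : I → ℝ | ∀ i, w i < 0} := by
    have : {w : I → ℝ | ∀ i, w i < 0} = Set.univ.pi fun _ => Set.Iio 0 := by ext; simp
    rw [this]
    exact isOpen_set_pi Set.finite_univ fun _ _ => isOpen_Iio
  have hK : Convex ℝ ((Matrix.mulVecLin M) '' stdSimplex ℝ J) :=
    (convex_stdSimplex ℝ J).linear_image _
  have hdisj : Disjoint {w : I → ℝ | ∀ i, w i < 0} ((Matrix.mulVecLin M) '' stdSimplex ℝ J) := by
    rw [Set.disjoint_left]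
    rintro w hw ⟨y, hy, rfl⟩
    obtain ⟨i, hi⟩ := h y hy
    exact absurd (hw i) (not_lt.2 hi)
  -- Separate the open negative orthant from the image of the simplex; the coefficients of the
  -- separating functional, once normalised, are the mixed action sought.
  obtain ⟨f, u, hf, hu⟩ := geometric_hahn_banach_open hconv hopen hK hdisj
  have hfe : ∀ w : I → ℝ, f w = ∑ i, w i * f (Pi.single i 1) := by
    intro w
    conv_lhs => rw [pi_eq_sum_univ' w]
    simp [map_sum]
  have hu0 : 0 ≤ u := by
    by_contra hneg
    push Not at hneg
    have hcl : (0 : I → ℝ) ∈ closure {w : I → ℝ | ∀ i, w i < 0} := by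
      refine mem_closure_of_tendsto (f := fun n : ℕ => fun _ : I => -(1 / ((n : ℝ) + 1)))
        (b := atTop) ?_ (Eventually.of_forall fun n i => ?_)
      · rw [tendsto_pi_nhds]
        intro i
        simpa using (tendsto_one_div_add_atTop_nhds_zero_nat (𝕜 := ℝ)).neg
      · have : (0 : ℝ) < 1 / ((n : ℝ) + 1) := by positivity
        simpa using this
    have h1 : (0 : I → ℝ) ∈ {w | f w ≤ u} :=
      closure_minimal (fun w hw => (hf w hw).le)
        (isClosed_le f.continuous continuous_const) hcl
    simp at h1
    linarith
  have hpos : ∀ i, 0 ≤ f (Pi.single i 1) := by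
    intro i
    by_contra hneg
    push Not at hneg
    set a := f (Pi.single i 1) with ha
    -- Moving from (-1, …, -1) in the direction of minus the `i`-th basis vector stays in the
    -- orthant, so a negative coefficient would make `f` exceed `u` there.
    set b := f (fun _ => (-1 : ℝ)) with hb
    have key : ∀ t : ℝ, 0 ≤ t → b - t * a < u := by
      intro t ht
      have := hf ((fun _ => (-1 : ℝ)) - t • Pi.single i 1) (by
        intro k
        by_cases hk : k = i
        · subst hk; simp; linarith
        · simp [hk])
      simpa [map_sub, map_smul] using this
    have h1 := key ((|u| + |b|) / (-a)) (div_nonneg (by positivity) (by linarith))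
    have h2 : (|u| + |b|) / (-a) * a = -(|u| + |b|) := by
      field_simp [hneg.ne]
    rw [h2] at h1
    linarith [le_abs_self u, neg_abs_le b]
  have hsum : 0 < ∑ i, f (Pi.single i 1) := by
    rcases (Finset.sum_nonneg fun i _ => hpos i).lt_or_eq with h0 | h0
    · exact h0
    exfalso
    have hz := (Finset.sum_eq_zero_iff_of_nonneg fun i _ => hpos i).1 h0.symm
    have hfz : ∀ w, f w = 0 := fun w => by
      rw [hfe]; exact Finset.sum_eq_zero fun i hi => by rw [hz i hi, mul_zero]
    have h1 := hf (fun _ => -1) (fun _ => by norm_num)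
    obtain ⟨j⟩ := ‹Nonempty J›
    have h2 := hu _ ⟨Pi.single j 1, single_mem_stdSimplex ℝ j, rfl⟩
    rw [hfz] at h1 h2
    linarith
  refine ⟨fun i => (∑ i, f (Pi.single i 1))⁻¹ * f (Pi.single i 1), ⟨fun i => ?_, ?_⟩, fun j => ?_⟩
  · exact mul_nonneg (inv_nonneg.2 hsum.le) (hpos i)
  · rw [← Finset.mul_sum, inv_mul_cancel₀ hsum.ne']
  · have h2 := hu _ ⟨Pi.single j 1, single_mem_stdSimplex ℝ j, rfl⟩
    rw [hfe] at h2
    have : (fun i => (∑ i, f (Pi.single i 1))⁻¹ * f (Pi.single i 1)) ᵥ* M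
        = (∑ i, f (Pi.single i 1))⁻¹ • fun j => ∑ i, M i j * f (Pi.single i 1) := by
      ext j
      simp only [vecMul, dotProduct, Pi.smul_apply, smul_eq_mul, Finset.mul_sum]
      exact Finset.sum_congr rfl fun i _ => by ring
    rw [this]
    refine mul_nonneg (inv_nonneg.2 hsum.le) ?_
    simpa using hu0.trans h2

/-- `v` is the value of the matrix game `M`, with optimal strategies `x` and `y`. -/
structure IsMatrixValue (M : Matrix I J ℝ) (v : ℝ) (x : I → ℝ) (y : J → ℝ) : Prop where
  left_mem : x ∈ stdSimplex ℝ I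
  right_mem : y ∈ stdSimplex ℝ J
  le_left : ∀ j, v ≤ (x ᵥ* M) j
  right_le : ∀ i, (M *ᵥ y) i ≤ v

theorem le_sum_mul_of_mem_stdSimplex {y : J → ℝ} (hy : y ∈ stdSimplex ℝ J) {f : J → ℝ} {v : ℝ}
    (h : ∀ j, v ≤ f j) : v ≤ ∑ j, f j * y j := by
  calc v = ∑ j, v * y j := by rw [← Finset.mul_sum, hy.2, mul_one]
    _ ≤ _ := Finset.sum_le_sum fun j _ => mul_le_mul_of_nonneg_right (h j) (hy.1 j)

theorem sum_mul_le_of_mem_stdSimplex {y : J → ℝ} (hy : y ∈ stdSimplex ℝ J) {f : J → ℝ} {v : ℝ}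
    (h : ∀ j, f j ≤ v) : ∑ j, f j * y j ≤ v := by
  calc _ ≤ ∑ j, v * y j :=
        Finset.sum_le_sum fun j _ => mul_le_mul_of_nonneg_right (h j) (hy.1 j)
    _ = v := by rw [← Finset.mul_sum, hy.2, mul_one]

/-- **Von Neumann's minimax theorem**. -/
theorem exists_isMatrixValue [Nonempty I] [Nonempty J] (M : Matrix I J ℝ) :
    ∃ v x y, IsMatrixValue M v x y := by
  classical
  have hI : (stdSimplex ℝ I).Nonempty :=
    ⟨_, single_mem_stdSimplex ℝ (Classical.arbitrary I)⟩
  have hJ : (stdSimplex ℝ J).Nonempty :=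
    ⟨_, single_mem_stdSimplex ℝ (Classical.arbitrary J)⟩
  have hcI : Continuous fun x : I → ℝ =>
      Finset.univ.inf' Finset.univ_nonempty fun j => (x ᵥ* M) j := by
    refine Continuous.finset_inf'_apply _ fun j _ => ?_
    simp only [vecMul, dotProduct]
    fun_prop
  have hcJ : Continuous fun y : J → ℝ =>
      Finset.univ.sup' Finset.univ_nonempty fun i => (M *ᵥ y) i := by
    refine Continuous.finset_sup'_apply _ fun i _ => ?_
    simp only [mulVec, dotProduct]
    fun_prop
  obtain ⟨x, hx, hxmax⟩ := (isCompact_stdSimplex ℝ I).exists_isMaxOn hI hcI.continuousOn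
  obtain ⟨y, hy, hymin⟩ := (isCompact_stdSimplex ℝ J).exists_isMinOn hJ hcJ.continuousOn
  set v := Finset.univ.inf' Finset.univ_nonempty fun j => (x ᵥ* M) j with hv
  set w := Finset.univ.sup' Finset.univ_nonempty fun i => (M *ᵥ y) i with hw
  have hwv : w ≤ v := by
    by_contra hlt
    push Not at hlt
    -- In a gap between maxmin and minmax, Ville's alternative for `M - c` would improve on `x` or
    -- on `y`.
    set c := (v + w) / 2 with hc
    rcases exists_stdSimplex_vecMul_nonneg_or_mulVec_neg (M - Matrix.of fun _ _ => c) with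
      ⟨x', hx', h'⟩ | ⟨y', hy', h'⟩
    · have h1 : c ≤ Finset.univ.inf' Finset.univ_nonempty fun j => (x' ᵥ* M) j := by
        refine Finset.le_inf' _ _ fun j _ => ?_
        have := h' j
        rw [vecMul_sub] at this
        simp [vecMul, dotProduct, ← Finset.sum_mul, hx'.2] at this
        simpa [vecMul, dotProduct] using this
      have h2 := hxmax hx'
      simp only [Set.mem_ofPred_eq] at h2
      linarith
    · have h1 : (Finset.univ.sup' Finset.univ_nonempty fun i => (M *ᵥ y') i) ≤ c := by
        refine Finset.sup'_le _ _ fun i _ => ?_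
        have := h' i
        rw [sub_mulVec] at this
        simp [mulVec, dotProduct, ← Finset.mul_sum, hy'.2] at this
        simpa [mulVec, dotProduct] using this.le
      have h2 := hymin hy'
      simp only [Set.mem_ofPred_eq] at h2
      linarith
  exact ⟨v, x, y, hx, hy, fun j => Finset.inf'_le _ (Finset.mem_univ j),
    fun i => (Finset.le_sup' (fun i => (M *ᵥ y) i) (Finset.mem_univ i)).trans hwv⟩

/-- Comparison of the values of two matrix games. -/
theorem IsMatrixValue.le_add {M M' : Matrix I J ℝ} {v v' : ℝ} {x x' : I → ℝ} {y y' : J → ℝ}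
    (h : IsMatrixValue M v x y) (h' : IsMatrixValue M' v' x' y') {d : ℝ}
    (hd : ∀ i j, M i j ≤ M' i j + d) : v ≤ v' + d := by
  -- Play the optimal `x` of the first game against the optimal `y'` of the second.
  have h1 : v ≤ ∑ j, (x ᵥ* M) j * y' j := le_sum_mul_of_mem_stdSimplex h'.right_mem h.le_left
  have h2 : ∑ j, (x ᵥ* M) j * y' j = ∑ i, (M *ᵥ y') i * x i := by
    have := dotProduct_mulVec x M y'
    simp only [dotProduct] at this
    rw [← this]
    exact Finset.sum_congr rfl fun i _ => mul_comm _ _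
  rw [h2] at h1
  refine h1.trans (sum_mul_le_of_mem_stdSimplex h.left_mem fun i => ?_)
  calc (M *ᵥ y') i ≤ ∑ j, (M' i j + d) * y' j :=
        Finset.sum_le_sum fun j _ => mul_le_mul_of_nonneg_right (hd i j) (h'.right_mem.1 j)
    _ = (M' *ᵥ y') i + d := by
        simp only [add_mul, Finset.sum_add_distrib, ← Finset.mul_sum, h'.right_mem.2, mul_one]
        rfl
    _ ≤ v' + d := by linarith [h'.right_le i]

end MatrixGame

/-! ### Shapley–Snow kernels: extreme optimal strategies and nullity-one submatrices -/

section Kernel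

open Matrix

/-- A subspace containing a nonzero nonnegative vector contains one which spans the vectors of the
subspace with smaller support. -/
theorem Submodule.exists_nonneg_minimal_support {K : Type*} [Fintype K] (V : Submodule ℝ (K → ℝ))
    (h : ∃ u ∈ V, 0 ≤ u ∧ u ≠ 0) :
    ∃ u ∈ V, 0 ≤ u ∧ u ≠ 0 ∧
      ∀ u' ∈ V, Function.support u' ⊆ Function.support u → ∃ c : ℝ, u' = c • u := by
  classical
  obtain ⟨u, ⟨huV, hu0, hune⟩, hmin⟩ := exists_minimalFor_of_wellFoundedLT
    (fun u : K → ℝ => u ∈ V ∧ 0 ≤ u ∧ u ≠ 0)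
    (fun u => (Finset.univ.filter fun k => u k ≠ 0).card) h
  refine ⟨u, huV, hu0, hune, fun u' hu'V hsupp => ?_⟩
  by_contra hc
  push Not at hc
  have hu'0 : u' ≠ 0 := fun h => hc 0 (by simp [h])
  obtain ⟨k1, hk1⟩ := Function.ne_iff.1 hu'0
  have hsupp' : ∀ k, u' k ≠ 0 → u k ≠ 0 := fun k hk => hsupp hk
  -- Maximising |u'|/u makes `u k / u' k` the shortest step along `u'` that cancels a coordinate of
  -- `u`; the result stays nonnegative and has smaller support.
  obtain ⟨k, hk, hkmax⟩ := Finset.exists_max_image (Finset.univ.filter fun k => u k ≠ 0)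
    (fun k => |u' k| / u k) ⟨k1, by simpa using hsupp' k1 hk1⟩
  simp only [Finset.mem_filter, Finset.mem_univ, true_and] at hk hkmax
  have hpos : ∀ j, u j ≠ 0 → 0 < u j := fun j hj => lt_of_le_of_ne (hu0 j) hj.symm
  have hk' : u' k ≠ 0 := by
    intro h0
    have := hkmax k1 (hsupp' k1 hk1)
    rw [h0, abs_zero, zero_div] at this
    exact absurd this (not_le.2 (div_pos (abs_pos.2 hk1) (hpos k1 (hsupp' k1 hk1))))
  set t := u k / u' k with ht
  have htne : t ≠ 0 := div_ne_zero hk hk'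
  have hw0 : 0 ≤ u - t • u' := by
    intro j
    simp only [Pi.zero_apply, Pi.sub_apply, Pi.smul_apply, smul_eq_mul, sub_nonneg]
    by_cases hj : u j = 0
    · have : u' j = 0 := by by_contra h; exact hsupp' j h hj
      simp [hj, this]
    · have h1 := hkmax j hj
      rw [div_le_div_iff₀ (hpos j hj) (hpos k hk)] at h1
      calc t * u' j ≤ |t * u' j| := le_abs_self _
        _ = |u' j| * u k / |u' k| := by
          rw [ht, abs_mul, abs_div, abs_of_pos (hpos k hk)]; ring
        _ ≤ |u' k| * u j / |u' k| := by gcongr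
        _ = u j := by field_simp
  have hwne : u - t • u' ≠ 0 := by
    intro h0
    refine hc t⁻¹ ?_
    rw [sub_eq_zero.1 h0, smul_smul, inv_mul_cancel₀ htne, one_smul]
  have hlt : (Finset.univ.filter fun j => (u - t • u') j ≠ 0) ⊂
      Finset.univ.filter fun j => u j ≠ 0 := by
    rw [Finset.ssubset_iff_of_subset]
    · refine ⟨k, by simpa using hk, ?_⟩
      simp [ht, hk']
    · intro j
      simp only [Finset.mem_filter, Finset.mem_univ, true_and]
      intro hj hj0
      have : u' j = 0 := by by_contra h; exact hsupp' j h hj0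
      simp [hj0, this] at hj
  have := hmin ⟨V.sub_mem huV (V.smul_mem t hu'V), hw0, hwne⟩ (Finset.card_le_card hlt.subset)
  exact absurd (Finset.card_lt_card hlt) (not_lt.2 this)

/-- Extreme rays of the cone of nonnegative `x` with `x ᵥ* W` nonnegative. -/
theorem Matrix.exists_extreme_vecMul_nonneg {I J : Type*} [Fintype I] [Fintype J]
    (W : Matrix I J ℝ) (h : ∃ x : I → ℝ, 0 ≤ x ∧ x ≠ 0 ∧ 0 ≤ x ᵥ* W) :
    ∃ x : I → ℝ, 0 ≤ x ∧ x ≠ 0 ∧ 0 ≤ x ᵥ* W ∧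
      ∀ x' : I → ℝ, (∀ i, x i = 0 → x' i = 0) → (∀ j, (x ᵥ* W) j = 0 → (x' ᵥ* W) j = 0) →
        ∃ c : ℝ, x' = c • x := by
  -- The support of `L x` is the set of constraints that are slack at `x`, so minimal support means
  -- extreme ray.
  let L : (I → ℝ) →ₗ[ℝ] (I ⊕ J → ℝ) :=
    { toFun := fun x => Sum.elim x (x ᵥ* W)
      map_add' := fun x y => by
        ext (i | j) <;> simp [add_vecMul]
      map_smul' := fun c x => by
        ext (i | j) <;> simp [smul_vecMul] }
  have hL : ∀ x, L x = Sum.elim x (x ᵥ* W) := fun _ => rfl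
  obtain ⟨x, hx0, hxne, hxW⟩ := h
  obtain ⟨u, ⟨x, rfl⟩, hu0, hune, hu⟩ := (LinearMap.range L).exists_nonneg_minimal_support
    ⟨L x, ⟨x, rfl⟩, by rintro (i | j); exacts [hx0 i, hxW j],
      fun h0 => hxne (by ext i; exact congrFun h0 (Sum.inl i))⟩
  refine ⟨x, fun i => hu0 (Sum.inl i), fun h0 => hune (by rw [h0, map_zero]),
    fun j => hu0 (Sum.inr j), fun x' h1 h2 => ?_⟩
  obtain ⟨c, hc⟩ := hu (L x') ⟨x', rfl⟩ (by
    intro k hk hk0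
    rcases k with i | j
    · exact hk (h1 i hk0)
    · exact hk (h2 j hk0))
  exact ⟨c, by ext i; exact congrFun hc (Sum.inl i)⟩

/-- The rows outside `i₀` contain a basis of the row space which, together with row `i₀`,
contains the support of the left null vector `x`. -/
theorem Matrix.exists_row_basis_of_extreme {R C : Type*} [Fintype R] [Fintype C]
    (M : Matrix R C ℝ) (x : R → ℝ) (hM : x ᵥ* M = 0)
    (hx : ∀ x' : R → ℝ, (∀ i, x i = 0 → x' i = 0) → x' ᵥ* M = 0 → ∃ c : ℝ, x' = c • x)
    (i₀ : R) (hi₀ : x i₀ ≠ 0) :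
    ∃ b : Set R, i₀ ∉ b ∧ (∀ i, x i ≠ 0 → i = i₀ ∨ i ∈ b) ∧ LinearIndepOn ℝ M.row b ∧
      ∀ i, M i ∈ Submodule.span ℝ (M.row '' b) := by
  classical
  have hvm : ∀ a : R → ℝ, a ᵥ* M = ∑ i, a i • M.row i := fun a => by
    ext j; simp [vecMul, dotProduct, Finset.sum_apply, Matrix.row]
  -- A relation among these rows is a left null vector supported in that of `x`, hence a multiple of
  -- `x`; as it vanishes at `i₀`, it is zero.
  have hs : LinearIndepOn ℝ M.row {i | x i ≠ 0 ∧ i ≠ i₀} := by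
    rw [linearIndepOn_iff']
    intro t a ht hsum i hi
    obtain ⟨c, hc⟩ := hx (fun i => if i ∈ t then a i else 0) (by
      intro i hi
      by_cases h : i ∈ t
      · exact absurd hi (ht h).1
      · simp [h]) (by
      rw [hvm, ← hsum]
      simp [ite_smul, Finset.sum_ite_mem])
    have h0 := congrFun hc i₀
    have hn : i₀ ∉ t := fun h => (ht h).2 rfl
    simp only [hn, if_false, Pi.smul_apply, smul_eq_mul] at h0
    have hc0 : c = 0 := by
      rcases mul_eq_zero.1 h0.symm with h | h
      · exact h
      · exact absurd h hi₀
    have := congrFun hc i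
    simpa [hi, hc0] using this
  obtain ⟨b, -, hsb, hspan, hb⟩ := exists_linearIndepOn_extension hs (Set.subset_univ _)
  -- If `i₀` were in `b`, the whole support of `x` would be, and `x` would be a nontrivial relation
  -- among independent rows.
  refine ⟨b, fun hmem => ?_, fun i hi => ?_, hb, fun i => hspan ⟨i, trivial, rfl⟩⟩
  · have := (linearIndepOn_iff'.1 hb) (Finset.univ.filter fun i => x i ≠ 0) x (by
      intro i hi
      simp only [Finset.coe_filter, Finset.mem_univ, true_and, Set.mem_ofPred_eq] at hi
      by_cases h : i = i₀
      · rwa [h]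
      · exact hsb ⟨hi, h⟩) (by
      rw [Finset.sum_filter_of_ne, ← hvm, hM]
      intro i _ h h0
      exact h (by rw [h0, zero_smul])) i₀ (by simpa using hi₀)
    exact hi₀ this
  · by_cases h : i = i₀
    · exact Or.inl h
    · exact Or.inr (hsb ⟨hi, h⟩)

theorem Matrix.card_eq_rank_of_row_basis {R C : Type*} [Fintype R] [Fintype C]
    (M : Matrix R C ℝ) (b : Set R) [Fintype b] (hb : LinearIndepOn ℝ M.row b)
    (hspan : ∀ i, M i ∈ Submodule.span ℝ (M.row '' b)) : Fintype.card b = M.rank := by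
  rw [Matrix.rank_eq_finrank_span_row]
  have : Submodule.span ℝ (Set.range M.row) = Submodule.span ℝ (Set.range fun i : b => M.row i) := by
    apply le_antisymm
    · rw [Submodule.span_le]
      rintro _ ⟨i, rfl⟩
      have := hspan i
      rwa [Set.image_eq_range] at this
    · refine Submodule.span_mono ?_
      rintro _ ⟨i, rfl⟩
      exact ⟨i, rfl⟩
  rw [this]
  exact (finrank_span_eq_card hb).symm

/-- A matrix with extreme left and right null vectors has a square submatrix containing their
supports, and of nullity one. -/
theorem Matrix.exists_submatrix_nullity_one {R C : Type*} [Fintype R] [Fintype C]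
    (M : Matrix R C ℝ) (x : R → ℝ) (hxM : x ᵥ* M = 0) (hx0 : x ≠ 0)
    (hx : ∀ x' : R → ℝ, (∀ i, x i = 0 → x' i = 0) → x' ᵥ* M = 0 → ∃ c : ℝ, x' = c • x)
    (y : C → ℝ) (hyM : M *ᵥ y = 0) (hy0 : y ≠ 0)
    (hy : ∀ y' : C → ℝ, (∀ i, y i = 0 → y' i = 0) → M *ᵥ y' = 0 → ∃ c : ℝ, y' = c • y) :
    ∃ (m : ℕ) (r : Fin m → R) (c : Fin m → C), (∃ k, x (r k) ≠ 0) ∧ (∃ k, y (c k) ≠ 0) ∧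
      (x ∘ r) ᵥ* M.submatrix r c = 0 ∧
      M.submatrix r c *ᵥ (y ∘ c) = 0 ∧
      ∀ p, M.submatrix r c *ᵥ p = 0 → ∃ a : ℝ, p = a • (y ∘ c) := by
  classical
  obtain ⟨i₀, hi₀⟩ := Function.ne_iff.1 hx0
  obtain ⟨j₀, hj₀⟩ := Function.ne_iff.1 hy0
  obtain ⟨b, hib, hbs, hbl, hbspan⟩ := M.exists_row_basis_of_extreme x hxM hx i₀ hi₀
  obtain ⟨d, hjd, hds, hdl, hdspan⟩ := Mᵀ.exists_row_basis_of_extreme y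
    (by rw [vecMul_transpose, hyM]) (fun y' h1 h2 => hy y' h1 (by rwa [vecMul_transpose] at h2))
    j₀ hj₀
  -- Both bases have `M.rank` elements, so adjoining row `i₀` and column `j₀` gives a square
  -- submatrix of size rank plus one.
  have hcard : Fintype.card (Option b) = Fintype.card (Option d) := by
    rw [Fintype.card_option, Fintype.card_option, M.card_eq_rank_of_row_basis b hbl hbspan,
      Mᵀ.card_eq_rank_of_row_basis d hdl hdspan, Matrix.rank_transpose]
  let eb : Fin (Fintype.card (Option b)) ≃ Option b := (Fintype.equivFin _).symm
  let ed : Fin (Fintype.card (Option b)) ≃ Option d := (Fintype.equivFinOfCardEq hcard.symm).symm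
  let r : Option b → R := fun o => o.elim i₀ Subtype.val
  let c : Option d → C := fun o => o.elim j₀ Subtype.val
  have hr : Function.Injective r := by
    rintro (_ | i) (_ | i') h
    · rfl
    · exact absurd (show i₀ ∈ b from (show i₀ = i' from h) ▸ i'.2) hib
    · exact absurd (show i₀ ∈ b from (show (i : R) = i₀ from h) ▸ i.2) hib
    · exact congrArg some (Subtype.ext h)
  have hc : Function.Injective c := by
    rintro (_ | i) (_ | i') h
    · rfl
    · exact absurd (show j₀ ∈ d from (show j₀ = i' from h) ▸ i'.2) hjd
    · exact absurd (show j₀ ∈ d from (show (i : C) = j₀ from h) ▸ i.2) hjd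
    · exact congrArg some (Subtype.ext h)
  have hxr : ∀ i ∉ Set.range (r ∘ eb), x i = 0 := by
    intro i hi
    by_contra h
    rw [EquivLike.range_comp] at hi
    rcases hbs i h with rfl | h'
    · exact hi ⟨none, rfl⟩
    · exact hi ⟨some ⟨i, h'⟩, rfl⟩
  have hyc : ∀ j ∉ Set.range (c ∘ ed), y j = 0 := by
    intro j hj
    by_contra h
    rw [EquivLike.range_comp] at hj
    rcases hds j h with rfl | h'
    · exact hj ⟨none, rfl⟩
    · exact hj ⟨some ⟨j, h'⟩, rfl⟩
  have hSy : M.submatrix (r ∘ eb) (c ∘ ed) *ᵥ (y ∘ (c ∘ ed)) = 0 := by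
    ext k
    have := congrFun hyM (r (eb k))
    simp only [mulVec, dotProduct] at this ⊢
    rw [Pi.zero_apply] at this ⊢
    rw [← this]
    exact Fintype.sum_of_injective (c ∘ ed) (hc.comp ed.injective) _ _
      (fun j hj => by simp [hyc j hj]) (fun _ => rfl)
  refine ⟨_, r ∘ eb, c ∘ ed, ⟨eb.symm none, by simpa [r] using hi₀⟩,
    ⟨ed.symm none, by simpa [c] using hj₀⟩, ?_, hSy, ?_⟩
  · ext k
    have := congrFun hxM (c (ed k))
    simp only [vecMul, dotProduct] at this ⊢
    rw [Pi.zero_apply] at this ⊢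
    rw [← this]
    exact Fintype.sum_of_injective (r ∘ eb) (hr.comp eb.injective) _ _
      (fun j hj => by simp [hxr j hj]) (fun _ => rfl)
  · intro p hp
    -- Subtracting this multiple of `y` kills the coordinate at `j₀`, leaving a relation among the
    -- columns in `d`, known only on the chosen rows. The rows in `b` span all rows, so it holds
    -- everywhere, and independence of the columns makes it trivial.
    set a := p (ed.symm none) / y j₀ with ha
    refine ⟨a, ?_⟩
    set p' := p - a • (y ∘ (c ∘ ed)) with hp'
    have hp'0 : p' (ed.symm none) = 0 := by
      simp [hp', ha, c, div_mul_cancel₀ _ hj₀]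
    have hSp' : M.submatrix (r ∘ eb) (c ∘ ed) *ᵥ p' = 0 := by
      rw [hp', mulVec_sub, mulVec_smul, hSy, hp]; simp
    have hall : ∀ i, ∑ j : d, M i j * p' (ed.symm (some j)) = 0 := by
      let φ : (C → ℝ) →ₗ[ℝ] ℝ :=
        ∑ j : d, p' (ed.symm (some j)) • LinearMap.proj (j : C)
      have hφ : ∀ w, φ w = ∑ j : d, w j * p' (ed.symm (some j)) := fun w => by
        simp [φ, LinearMap.sum_apply, mul_comm]
      have hle : Submodule.span ℝ (M.row '' b) ≤ LinearMap.ker φ := by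
        rw [Submodule.span_le]
        rintro _ ⟨i, hi, rfl⟩
        have h1 := congrFun hSp' (eb.symm (some ⟨i, hi⟩))
        simp only [mulVec, dotProduct, submatrix_apply, Function.comp_apply,
          Equiv.apply_symm_apply, Pi.zero_apply] at h1
        rw [← ed.symm.sum_comp, Fintype.sum_option, hp'0, mul_zero, zero_add] at h1
        simp only [Equiv.apply_symm_apply] at h1
        rw [SetLike.mem_coe, LinearMap.mem_ker, hφ]
        exact h1
      intro i
      rw [← hφ]
      exact hle (hbspan i)
    have hzero : ∀ j : d, p' (ed.symm (some j)) = 0 := by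
      have hli : LinearIndependent ℝ fun j : d => Mᵀ.row j := hdl
      refine Fintype.linearIndependent_iff.1 hli _ ?_
      ext i
      rw [Finset.sum_apply, Pi.zero_apply, ← hall i]
      exact Finset.sum_congr rfl fun j _ => mul_comm _ _
    have : p' = 0 := by
      ext k
      obtain ⟨o, rfl⟩ := ed.symm.surjective k
      rcases o with _ | j
      · exact hp'0
      · exact hzero j
    exact sub_eq_zero.1 this

/-- If `S` has nullity one and left and right null vectors `x`, `y` with `x B y ≠ 0`, then
`det (S - ε B)` does not vanish identically. -/
theorem Matrix.exists_det_sub_smul_ne_zero {m : ℕ} (S B : Matrix (Fin m) (Fin m) ℝ)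
    (x y : Fin m → ℝ) (hx : x ᵥ* S = 0) (hy : ∀ p, S *ᵥ p = 0 → ∃ a : ℝ, p = a • y)
    (hB : x ⬝ᵥ (B *ᵥ y) ≠ 0) : ∃ ε : ℝ, (S - ε • B).det ≠ 0 := by
  classical
  by_contra! hdet
  let P : Matrix (Fin m) (Fin m) ℝ[X] := S.map C - (X : ℝ[X]) • B.map C
  have hP : P.det = 0 := by
    refine Polynomial.funext fun ε => ?_
    rw [eval_zero, ← hdet ε, ← coe_evalRingHom, RingHom.map_det]
    congr 1
    ext i j
    simp [P, RingHom.mapMatrix_apply]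
    ring
  -- An identically zero determinant yields a nonzero polynomial kernel vector. Its lowest nonzero
  -- coefficient is killed by `S`, hence is a multiple of `y`; pairing the next-order equation with
  -- `x` contradicts `hB`.
  obtain ⟨p, hp0, hp⟩ := Matrix.exists_mulVec_eq_zero_iff.2 hP
  have hcoef : ∀ (k : ℕ) (i : Fin m), ∑ j, S i j * (p j).coeff (k + 1) =
      ∑ j, B i j * (p j).coeff k := by
    intro k i
    have h1 := congrArg (fun q : ℝ[X] => q.coeff (k + 1)) (congrFun hp i)
    simp only [mulVec, dotProduct, P, sub_apply, smul_apply, map_apply, smul_eq_mul, sub_mul,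
      Finset.sum_sub_distrib, coeff_sub, finsetSum_coeff, Pi.zero_apply, coeff_zero, coeff_C_mul,
      mul_assoc, coeff_X_mul] at h1
    linarith
  have hcoef0 : ∀ i : Fin m, ∑ j, S i j * (p j).coeff 0 = 0 := by
    intro i
    have h1 := congrArg (fun q : ℝ[X] => q.coeff 0) (congrFun hp i)
    simpa [mulVec, dotProduct, P, sub_mul, Finset.sum_sub_distrib, finsetSum_coeff, mul_assoc,
      mul_coeff_zero] using h1
  have hex : ∃ k, (fun j => (p j).coeff k) ≠ 0 := by
    obtain ⟨j, hj⟩ := Function.ne_iff.1 hp0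
    exact ⟨(p j).natDegree, fun h => hj (leadingCoeff_eq_zero.1 (congrFun h j))⟩
  have hk := Nat.find_spec hex
  set k := Nat.find hex with hkdef
  have hSk : S *ᵥ (fun j => (p j).coeff k) = 0 := by
    ext i
    rcases hk' : k with _ | k'
    · exact hcoef0 i
    · have hmin := Nat.find_min hex (m := k') (by omega)
      simp only [ne_eq, not_not] at hmin
      have := hcoef k' i
      simp only [mulVec, dotProduct, Pi.zero_apply]
      rw [this]
      exact Finset.sum_eq_zero fun j _ => by rw [show (p j).coeff k' = 0 from congrFun hmin j, mul_zero]
  obtain ⟨a, ha⟩ := hy _ hSk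
  have ha0 : a ≠ 0 := by
    rintro rfl
    exact hk (by rw [ha, zero_smul])
  have h1 : S *ᵥ (fun j => (p j).coeff (k + 1)) = B *ᵥ (fun j => (p j).coeff k) := by
    ext i; exact hcoef k i
  have h2 := congrArg (x ⬝ᵥ ·) h1
  simp only [dotProduct_mulVec, hx, zero_dotProduct, ha, dotProduct_smul, smul_eq_mul] at h2
  rw [← dotProduct_mulVec] at h2
  exact mul_ne_zero ha0 hB h2.symm

/-- If the matrix game `A - v B` with `B` positive has value zero, then `v` is a root of the
nonzero polynomial `det (A' - z B')` for some square submatrices `A'`, `B'`. -/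
theorem Matrix.exists_submatrix_det_eq_zero {I J : Type*} [Fintype I] [Fintype J]
    (A B : Matrix I J ℝ) (v : ℝ) (hB : ∀ i j, 0 < B i j)
    (hx : ∃ x : I → ℝ, 0 ≤ x ∧ x ≠ 0 ∧ 0 ≤ x ᵥ* (A - v • B))
    (hy : ∃ y : J → ℝ, 0 ≤ y ∧ y ≠ 0 ∧ (A - v • B) *ᵥ y ≤ 0) :
    ∃ (m : ℕ) (r : Fin m → I) (c : Fin m → J), ((A - v • B).submatrix r c).det = 0 ∧
      ∃ z : ℝ, ((A - z • B).submatrix r c).det ≠ 0 := by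
  classical
  set W := A - v • B with hW
  obtain ⟨x, hx0, hxne, hxW, hxext⟩ := W.exists_extreme_vecMul_nonneg hx
  obtain ⟨y, hy0, hyne, hyW, hyext⟩ := (-Wᵀ).exists_extreme_vecMul_nonneg (by
    obtain ⟨y, h1, h2, h3⟩ := hy
    refine ⟨y, h1, h2, ?_⟩
    rw [vecMul_neg, vecMul_transpose]
    exact neg_nonneg.2 h3)
  simp only [vecMul_neg, vecMul_transpose, Pi.neg_apply, neg_eq_zero] at hyW hyext
  rw [neg_nonneg] at hyW
  -- Complementary slackness: this sum is termwise nonpositive by rows and termwise nonnegative by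
  -- columns. Hence `x` and `y` live on the tight rows `R` and columns `C`, where they are null
  -- vectors.
  have hxy : x ⬝ᵥ (W *ᵥ y) = 0 := by
    apply le_antisymm
    · exact Finset.sum_nonpos fun i _ => mul_nonpos_of_nonneg_of_nonpos (hx0 i) (hyW i)
    · rw [dotProduct_mulVec]
      exact Finset.sum_nonneg fun j _ => mul_nonneg (hxW j) (hy0 j)
  have hx1 : ∀ i, x i * (W *ᵥ y) i = 0 := fun i =>
    (Finset.sum_eq_zero_iff_of_nonpos
      fun i _ => mul_nonpos_of_nonneg_of_nonpos (hx0 i) (hyW i)).1 hxy i (Finset.mem_univ i)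
  have hy1 : ∀ j, (x ᵥ* W) j * y j = 0 := fun j => by
    rw [dotProduct_mulVec] at hxy
    exact (Finset.sum_eq_zero_iff_of_nonneg
      fun j _ => mul_nonneg (hxW j) (hy0 j)).1 hxy j (Finset.mem_univ j)
  let R := {i : I // (W *ᵥ y) i = 0}
  let C := {j : J // (x ᵥ* W) j = 0}
  have hxR : ∀ i ∉ Set.range (Subtype.val : R → I), x i = 0 := fun i hi =>
    (mul_eq_zero.1 (hx1 i)).resolve_right fun h => hi ⟨⟨i, h⟩, rfl⟩
  have hyC : ∀ j ∉ Set.range (Subtype.val : C → J), y j = 0 := fun j hj =>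
    (mul_eq_zero.1 (hy1 j)).resolve_left fun h => hj ⟨⟨j, h⟩, rfl⟩
  have hvm : ∀ x' : I → ℝ, (∀ i, x i = 0 → x' i = 0) → ∀ j : C,
      ((fun i : R => x' i) ᵥ* W.submatrix (Subtype.val : R → I) (Subtype.val : C → J)) j
        = (x' ᵥ* W) j := fun x' h j =>
    Fintype.sum_of_injective _ Subtype.val_injective _ _
      (fun i hi => by simp [h i (hxR i hi)]) fun _ => rfl
  have hmv : ∀ y' : J → ℝ, (∀ j, y j = 0 → y' j = 0) → ∀ i : R,
      (W.submatrix (Subtype.val : R → I) (Subtype.val : C → J) *ᵥ (fun j : C => y' j)) i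
        = (W *ᵥ y') i := fun y' h i =>
    Fintype.sum_of_injective _ Subtype.val_injective _ _
      (fun j hj => by simp [h j (hyC j hj)]) fun _ => rfl
  obtain ⟨m, r, c, ⟨kr, hkr⟩, ⟨kc, hkc⟩, hxS, hSy, hS⟩ :=
    (W.submatrix (Subtype.val : R → I) (Subtype.val : C → J)).exists_submatrix_nullity_one
      (fun i : R => x i) (by ext j; rw [hvm x (fun _ h => h)]; exact j.2)
      (by
        obtain ⟨i, hi⟩ := Function.ne_iff.1 hxne
        have : i ∈ Set.range (Subtype.val : R → I) := by by_contra h; exact hi (hxR i h)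
        obtain ⟨i', rfl⟩ := this
        exact fun h => hi (congrFun h i'))
      (by
        intro x' h1 h2
        obtain ⟨a, ha⟩ := hxext (fun i => if h : (W *ᵥ y) i = 0 then x' ⟨i, h⟩ else 0)
          (fun i hi => by
            by_cases h : (W *ᵥ y) i = 0
            · simp only [h, dite_true]; exact h1 ⟨i, h⟩ hi
            · simp [h])
          (fun j hj => by
            refine Eq.trans ?_ (congrFun h2 ⟨j, hj⟩)
            refine (Fintype.sum_of_injective _ Subtype.val_injective _ _
              (fun i hi => ?_) fun i => ?_).symm
            · have : ¬ (W *ᵥ y) i = 0 := fun h => hi ⟨⟨i, h⟩, rfl⟩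
              simp [this]
            · simp [i.2])
        refine ⟨a, ?_⟩
        ext i
        have := congrFun ha i
        simpa [i.2] using this)
      (fun j : C => y j) (by ext i; rw [hmv y (fun _ h => h)]; exact i.2)
      (by
        obtain ⟨j, hj⟩ := Function.ne_iff.1 hyne
        have : j ∈ Set.range (Subtype.val : C → J) := by by_contra h; exact hj (hyC j h)
        obtain ⟨j', rfl⟩ := this
        exact fun h => hj (congrFun h j'))
      (by
        intro y' h1 h2
        obtain ⟨a, ha⟩ := hyext (fun j => if h : (x ᵥ* W) j = 0 then y' ⟨j, h⟩ else 0)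
          (fun j hj => by
            by_cases h : (x ᵥ* W) j = 0
            · simp only [h, dite_true]; exact h1 ⟨j, h⟩ hj
            · simp [h])
          (fun i hi => by
            refine Eq.trans ?_ (congrFun h2 ⟨i, hi⟩)
            refine (Fintype.sum_of_injective _ Subtype.val_injective _ _
              (fun j hj => ?_) fun j => ?_).symm
            · have : ¬ (x ᵥ* W) j = 0 := fun h => hj ⟨⟨j, h⟩, rfl⟩
              simp [this]
            · simp [j.2])
        refine ⟨a, ?_⟩
        ext j
        have := congrFun ha j
        simpa [j.2] using this)
  rw [submatrix_submatrix] at hxS hSy hS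
  -- The pairing x B y is positive, as `B` is positive and each of the nonnegative vectors keeps a
  -- nonzero coordinate in the submatrix.
  obtain ⟨ε, hε⟩ := Matrix.exists_det_sub_smul_ne_zero _
    (B.submatrix (Subtype.val ∘ r) (Subtype.val ∘ c)) _ _ hxS hS (by
      apply ne_of_gt
      refine Finset.sum_pos' (fun k _ => mul_nonneg (hx0 _) ?_) ⟨kr, Finset.mem_univ _, ?_⟩
      · exact Finset.sum_nonneg (s := Finset.univ) fun l _ =>
          mul_nonneg (hB (r k) (c l)).le (hy0 (c l))
      · refine mul_pos (lt_of_le_of_ne (hx0 _) (Ne.symm hkr)) ?_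
        exact Finset.sum_pos' (fun l _ => mul_nonneg (hB (r kr) (c l)).le (hy0 (c l)))
          ⟨kc, Finset.mem_univ _,
            mul_pos (hB (r kr) (c kc)) (lt_of_le_of_ne (hy0 (c kc)) (Ne.symm hkc))⟩)
  refine ⟨m, Subtype.val ∘ r, Subtype.val ∘ c, ?_, v + ε, ?_⟩
  · refine Matrix.exists_mulVec_eq_zero_iff.1 ⟨_, ?_, hSy⟩
    exact fun h => hkc (congrFun h kc)
  · convert hε using 2
    ext k l
    simp [hW]
    ring

end Kernel

/-! ### Defining polynomials and Mahler's measure -/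

section DefiningPolynomial

theorem IsDefiningPolynomial.ne_zero {P : ℤ[X]} {w : ℝ} (h : IsDefiningPolynomial P w) : P ≠ 0 :=
  h.2.2.1.ne_zero

theorem aeval_map_rat (w : ℝ) (P : ℤ[X]) : aeval w (P.map (Int.castRingHom ℚ)) = aeval w P :=
  aeval_map_algebraMap ℚ w P

/-- Since `P` is primitive, Gauss's lemma reduces divisibility to ℚ. Clearing denominators in the
minimal polynomial gives an integer competitor of the same degree, so minimality of `P` makes the
two associated over ℚ. -/
theorem IsDefiningPolynomial.dvd {P Q : ℤ[X]} {w : ℝ} (h : IsDefiningPolynomial P w)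
    (hQ : aeval w Q = 0) : P ∣ Q := by
  have hP0 := h.ne_zero
  have halg : IsAlgebraic ℤ w := ⟨P, hP0, h.1⟩
  have hint : IsIntegral ℚ w := (halg.extendScalars (Int.cast_injective (α := ℚ))).isIntegral
  rw [IsPrimitive.Int.dvd_iff_map_cast_dvd_map_cast _ _ h.2.2.1]
  have hm : minpoly ℚ w ∣ P.map (Int.castRingHom ℚ) :=
    minpoly.dvd ℚ w (by rw [aeval_map_rat, h.1])
  have hmQ : minpoly ℚ w ∣ Q.map (Int.castRingHom ℚ) :=
    minpoly.dvd ℚ w (by rw [aeval_map_rat, hQ])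
  obtain ⟨b, hbm, hb⟩ := IsLocalization.integerNormalization_spec (nonZeroDivisors ℤ)
    (minpoly ℚ w)
  set R := IsLocalization.integerNormalization (nonZeroDivisors ℤ) (minpoly ℚ w) with hR
  have hb0 : b ≠ 0 := nonZeroDivisors.ne_zero hbm
  have hR0 : R ≠ 0 := by
    intro h0
    rw [h0, Polynomial.map_zero] at hb
    exact smul_ne_zero hb0 (minpoly.ne_zero hint) hb.symm
  have hRw : aeval w R = 0 := by
    rw [← aeval_map_rat]
    change aeval w (R.map (algebraMap ℤ ℚ)) = 0
    rw [hb, map_zsmul, minpoly.aeval, smul_zero]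
  have hRd : R.natDegree = (minpoly ℚ w).natDegree := by
    rw [← natDegree_map_eq_of_injective (RingHom.injective_int (algebraMap ℤ ℚ)), hb]
    rw [← Int.cast_smul_eq_zsmul ℚ]
    exact natDegree_smul _ (by exact_mod_cast hb0)
  have hdeg : (P.map (Int.castRingHom ℚ)).natDegree ≤ (minpoly ℚ w).natDegree :=
    natDegree_map_le.trans ((h.2.2.2 R hR0 hRw).trans hRd.le)
  have hPm0 : P.map (Int.castRingHom ℚ) ≠ 0 :=
    (Polynomial.map_ne_zero_iff Int.cast_injective).2 hP0
  exact (associated_of_dvd_of_natDegree_le hm hPm0 hdeg).symm.dvd.trans hmQ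

/-- Take the primitive part of an annihilator of least degree, up to sign. Two candidates divide
each other, hence differ by a unit ±1, which the sign of the leading coefficient fixes. -/
theorem existsUnique_isDefiningPolynomial {w : ℝ} {Q : ℤ[X]} (hQ0 : Q ≠ 0) (hQ : aeval w Q = 0) :
    ∃! P : ℤ[X], IsDefiningPolynomial P w := by
  obtain ⟨R, ⟨hR0, hRw⟩, hmin⟩ := exists_minimalFor_of_wellFoundedLT
    (fun R : ℤ[X] => R ≠ 0 ∧ aeval w R = 0) natDegree ⟨Q, hQ0, hQ⟩
  have hmin' : ∀ S : ℤ[X], S ≠ 0 → aeval w S = 0 → R.natDegree ≤ S.natDegree := fun S h1 h2 => by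
    rcases le_total R.natDegree S.natDegree with h | h
    · exact h
    · exact hmin ⟨h1, h2⟩ h
  have hpw : aeval w R.primPart = 0 := by
    rw [R.eq_C_content_mul_primPart, map_mul, aeval_C] at hRw
    refine (mul_eq_zero.1 hRw).resolve_left ?_
    simpa [content_eq_zero_iff] using hR0
  have hex : ∃ P : ℤ[X], IsDefiningPolynomial P w := by
    rcases lt_trichotomy R.primPart.leadingCoeff 0 with h | h | h
    · refine ⟨-R.primPart, by rw [map_neg, hpw, neg_zero], by rw [leadingCoeff_neg]; omega,
        fun r hr => R.isPrimitive_primPart r ((dvd_neg).1 hr), ?_⟩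
      rw [natDegree_neg, natDegree_primPart]
      exact hmin'
    · exact absurd (leadingCoeff_eq_zero.1 h) R.primPart_ne_zero
    · refine ⟨R.primPart, hpw, h, R.isPrimitive_primPart, ?_⟩
      rw [natDegree_primPart]
      exact hmin'
  obtain ⟨P, hP⟩ := hex
  refine ⟨P, hP, fun P' hP' => ?_⟩
  obtain ⟨u, hu⟩ := associated_of_dvd_dvd (hP.dvd hP'.1) (hP'.dvd hP.1)
  obtain ⟨c, hc, hcu⟩ := Polynomial.isUnit_iff.1 u.isUnit
  have hl := congrArg leadingCoeff hu
  rw [leadingCoeff_mul, ← hcu, leadingCoeff_C] at hl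
  rcases Int.isUnit_iff.1 hc with rfl | rfl
  · rw [← hu, ← hcu]; simp
  · have := hP.2.1
    have := hP'.2.1
    omega

/-- Coefficients of the defining polynomial are controlled by any polynomial vanishing at `w`. -/
theorem IsDefiningPolynomial.abs_coeff_le {P Q : ℤ[X]} {w : ℝ} (h : IsDefiningPolynomial P w)
    (hQ0 : Q ≠ 0) (hQ : aeval w Q = 0) (i : ℕ) :
    |(P.coeff i : ℝ)| ≤ 2 ^ Q.natDegree * Q.sum fun _ a => |(a : ℝ)| := by
  obtain ⟨R, hR⟩ := h.dvd hQ
  have hR0 : R ≠ 0 := by rintro rfl; exact hQ0 (by rw [hR, mul_zero])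
  -- The cofactor `R` is a nonzero integer polynomial, so its Mahler measure is at least 1, and that
  -- of `P` is at most that of `Q`.
  have h1 := norm_coeff_le_choose_mul_mahlerMeasure_of_one_le_mahlerMeasure i
    (P.map (Int.castRingHom ℂ)) (R.map (Int.castRingHom ℂ)) (one_le_mahlerMeasure_of_ne_zero hR0)
  rw [← Polynomial.map_mul, ← hR, natDegree_map_eq_of_injective (RingHom.injective_int _)] at h1
  have h2 := mahlerMeasure_le_sum_norm_coeff (Q.map (Int.castRingHom ℂ))
  have h3 : ((Q.map (Int.castRingHom ℂ)).sum fun _ a => ‖a‖) = Q.sum fun _ a => |(a : ℝ)| := by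
    rw [sum_over_range' _ (by simp) (Q.natDegree + 1)
        (Nat.lt_succ_of_le natDegree_map_le),
      sum_over_range' _ (by simp) (Q.natDegree + 1) (Nat.lt_succ_self _)]
    refine Finset.sum_congr rfl fun k _ => ?_
    rw [coeff_map, eq_intCast, Complex.norm_intCast]
  rw [h3] at h2
  rw [coeff_map, eq_intCast, Complex.norm_intCast] at h1
  have h4 : ((P.natDegree.choose i : ℕ) : ℝ) ≤ 2 ^ Q.natDegree := by
    calc ((P.natDegree.choose i : ℕ) : ℝ) ≤ ((2 ^ P.natDegree : ℕ) : ℝ) := by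
          exact_mod_cast Nat.choose_le_two_pow _ _
      _ ≤ 2 ^ Q.natDegree := by
          push_cast
          exact pow_le_pow_right₀ (by norm_num) (h.2.2.2 Q hQ0 hQ)
  refine h1.trans ?_
  have := mahlerMeasure_nonneg (Q.map (Int.castRingHom ℂ))
  gcongr

end DefiningPolynomial

/-! ### The length of a polynomial as a ring seminorm -/

section LengthSeminorm

variable {R : Type*} [CommRing R]

theorem RingSeminorm.sum_coeff_add_le (ν : RingSeminorm R) (p q : R[X]) :
    ((p + q).sum fun _ a => ν a) ≤ (p.sum fun _ a => ν a) + q.sum fun _ a => ν a := by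
  have hp := sum_over_range' p (f := fun _ a => ν a) (by simp) (max p.natDegree q.natDegree + 1)
    (by omega)
  have hq := sum_over_range' q (f := fun _ a => ν a) (by simp) (max p.natDegree q.natDegree + 1)
    (by omega)
  have hpq := sum_over_range' (p + q) (f := fun _ a => ν a) (by simp)
    (max p.natDegree q.natDegree + 1) (Nat.lt_succ_of_le (natDegree_add_le p q))
  rw [hp, hq, hpq, ← Finset.sum_add_distrib]
  exact Finset.sum_le_sum fun i _ => by rw [coeff_add]; exact map_add_le_add ν _ _

/-- The sum of the seminorms of the coefficients of a polynomial. -/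
def RingSeminorm.length (ν : RingSeminorm R) : RingSeminorm R[X] where
  toFun p := p.sum fun _ a => ν a
  map_zero' := by simp
  add_le' := ν.sum_coeff_add_le
  neg' p := by simp [Polynomial.sum, support_neg]
  mul_le' p q := by
    have hz : ((0 : R[X]).sum fun _ a => ν a) ≤ 0 := by simp
    rw [mul_eq_sum_sum]
    simp only [Polynomial.sum_def q]
    refine (Finset.le_sum_of_subadditive (fun p : R[X] => p.sum fun _ a => ν a) hz
      ν.sum_coeff_add_le _ _).trans ?_
    simp only [Polynomial.sum_def p]
    rw [Finset.sum_mul]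
    refine Finset.sum_le_sum fun i _ => ?_
    refine (Finset.le_sum_of_subadditive (fun p : R[X] => p.sum fun _ a => ν a) hz
      ν.sum_coeff_add_le _ _).trans ?_
    rw [Finset.mul_sum]
    refine Finset.sum_le_sum fun j _ => ?_
    rw [sum_monomial_index _ _ (map_zero ν)]
    exact map_mul_le_mul ν _ _

theorem RingSeminorm.length_apply (ν : RingSeminorm R) (p : R[X]) :
    ν.length p = p.sum fun _ a => ν a := rfl

theorem RingSeminorm.length_C (ν : RingSeminorm R) (a : R) : ν.length (C a) = ν a := by
  rw [RingSeminorm.length_apply, sum_C_index (map_zero ν)]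

theorem RingSeminorm.length_X (ν : RingSeminorm R) : ν.length X = ν 1 := by
  rw [RingSeminorm.length_apply, sum_X_index (map_zero ν)]

theorem RingSeminorm.map_prod_le (ν : RingSeminorm R) (h1 : ν 1 ≤ 1) {ι : Type*} (s : Finset ι)
    (f : ι → R) : ν (∏ i ∈ s, f i) ≤ ∏ i ∈ s, ν (f i) := by
  classical
  induction s using Finset.induction_on with
  | empty => simpa using h1
  | insert a s ha ih =>
    rw [Finset.prod_insert ha, Finset.prod_insert ha]
    exact (map_mul_le_mul ν _ _).trans (mul_le_mul_of_nonneg_left ih (apply_nonneg ν _))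

/-- Expanding the product of row sums gives one nonnegative term for each map `ι → ι`; the Leibniz
formula uses only the permutations. The abstract seminorm allows the same bound for coefficients in
ℤ[X] and in ℤ[X][Y]. -/
theorem RingSeminorm.map_det_le (ν : RingSeminorm R) (h1 : ν 1 ≤ 1) {ι : Type*} [Fintype ι]
    [DecidableEq ι] (M : Matrix ι ι R) : ν M.det ≤ ∏ i, ∑ j, ν (M i j) := by
  rw [← Matrix.det_transpose, Matrix.det_apply, Finset.prod_univ_sum]
  refine (Finset.le_sum_of_subadditive ν (map_zero ν).le (map_add_le_add ν) _ _).trans ?_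
  calc ∑ σ : Equiv.Perm ι, ν (Equiv.Perm.sign σ • ∏ i, M.transpose (σ i) i)
      ≤ ∑ σ : Equiv.Perm ι, ∏ i, ν (M i (σ i)) := Finset.sum_le_sum fun σ _ => by
        refine le_trans (le_of_eq ?_) (ν.map_prod_le h1 _ _)
        rcases Int.units_eq_one_or (Equiv.Perm.sign σ) with h | h <;>
          simp [h, Matrix.transpose_apply]
    _ = ∑ f ∈ Finset.univ.image (fun σ : Equiv.Perm ι => (σ : ι → ι)), ∏ i, ν (M i (f i)) := by
        rw [Finset.sum_image]
        intro σ _ σ' _ h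
        exact Equiv.coe_fn_injective h
    _ ≤ _ := by
        refine Finset.sum_le_sum_of_subset_of_nonneg (fun f _ => ?_) fun f _ _ =>
          Finset.prod_nonneg fun i _ => apply_nonneg ν _
        simp

end LengthSeminorm

/-! ### Plane algebraic curves near the origin -/

section Bivariate

open Polynomial.Bivariate

/-- `swap` transposes the array of coefficients, so degree and length bounds on `F` pass to each
coefficient of `swap F`. -/
theorem Polynomial.Bivariate.coeff_coeff_swap {R : Type*} [CommRing R] (F : R[X][Y]) (i j : ℕ) :
    ((swap F).coeff i).coeff j = (F.coeff j).coeff i := by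
  induction F using Polynomial.induction_on' with
  | add p q hp hq => simp only [map_add, coeff_add, hp, hq]
  | monomial n a =>
    induction a using Polynomial.induction_on' with
    | add p q hp hq => simp only [map_add, coeff_add, hp, hq]
    | monomial m r =>
      rw [swap_monomial_monomial]
      simp only [coeff_monomial]
      split_ifs <;> simp_all [coeff_monomial]

theorem Polynomial.Bivariate.natDegree_coeff_swap_le {R : Type*} [CommRing R] (F : R[X][Y])
    (e : ℕ) : ((swap F).coeff e).natDegree ≤ F.natDegree := by
  rw [natDegree_le_iff_coeff_eq_zero]
  intro N hN
  rw [coeff_coeff_swap, coeff_eq_zero_of_natDegree_lt hN, coeff_zero]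

theorem RingSeminorm.map_coeff_le_length {R : Type*} [CommRing R] (ν : RingSeminorm R) (p : R[X])
    (e : ℕ) : ν (p.coeff e) ≤ ν.length p := by
  rw [RingSeminorm.length_apply]
  by_cases h : e ∈ p.support
  · exact Finset.single_le_sum (f := fun e => ν (p.coeff e)) (fun _ _ => apply_nonneg ν _) h
  · rw [notMem_support_iff.1 h, map_zero]
    exact Finset.sum_nonneg fun _ _ => apply_nonneg ν _

theorem RingSeminorm.length_coeff_swap_le {R : Type*} [CommRing R] (ν : RingSeminorm R)
    (F : R[X][Y]) (e : ℕ) : ν.length ((swap F).coeff e) ≤ ν.length.length F := by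
  rw [RingSeminorm.length_apply, RingSeminorm.length_apply,
    sum_over_range' _ (by simp) (F.natDegree + 1) (Nat.lt_succ_of_le (natDegree_coeff_swap_le F e)),
    sum_over_range' _ (by simp) (F.natDegree + 1) (Nat.lt_succ_self _)]
  refine Finset.sum_le_sum fun j _ => ?_
  rw [coeff_coeff_swap]
  exact ν.map_coeff_le_length _ _

theorem aevalAeval_apply_eq {R A : Type*} [CommRing R] [CommRing A] [Algebra R A] (x y : A)
    (n : ℕ) (a : R[X]) : aevalAeval x y (monomial n a : R[X][Y]) = aeval x a * y ^ n := by
  rw [← C_mul_X_pow_eq_monomial, map_mul, map_pow, aevalAeval_C, aevalAeval_Y]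

theorem continuous_aevalAeval (F : ℤ[X][Y]) :
    Continuous fun p : ℝ × ℝ => aevalAeval p.1 p.2 F := by
  induction F using Polynomial.induction_on' with
  | add p q hp hq => simp only [map_add]; exact hp.add hq
  | monomial n a =>
    simp only [aevalAeval_apply_eq]
    have := (Polynomial.continuous_aeval a (A := ℝ)).comp
      (continuous_fst : Continuous fun p : ℝ × ℝ => p.1)
    exact this.mul (continuous_snd.pow n)

/-- Along a branch `f` of the curve `F (t, f t) = 0`, the lowest coefficient of `F` in `t`
tends to zero as `t` tends to zero. -/
theorem tendsto_aeval_trailingCoeff_swap {F : ℤ[X][Y]} {f : ℝ → ℝ} {l : Filter ℝ}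
    (hl : l ≤ 𝓝[>] 0) (hf : ∀ᶠ t in l, f t ∈ Set.Icc 0 1)
    (hF : ∀ᶠ t in l, aevalAeval t (f t) F = 0) :
    Tendsto (fun t => aeval (f t) (swap F).trailingCoeff) l (𝓝 0) := by
  set s := (swap F).natTrailingDegree with hs
  obtain ⟨G, hG⟩ : X ^ s ∣ swap F :=
    X_pow_dvd_iff.2 fun d hd => coeff_eq_zero_of_lt_natTrailingDegree hd
  have hG0 : G.coeff 0 = (swap F).trailingCoeff := by
    rw [trailingCoeff, ← hs, hG]
    simpa using (coeff_X_pow_mul G s 0).symm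
  obtain ⟨K, hK⟩ := (isCompact_Icc.prod isCompact_Icc).exists_bound_of_continuousOn
    (s := Set.Icc (0 : ℝ) 1 ×ˢ Set.Icc (0 : ℝ) 1) (continuous_aevalAeval G.divX).continuousOn
  have ht0 : Tendsto (fun t : ℝ => t * K) l (𝓝 0) := by
    have : Tendsto (fun t : ℝ => t * K) (𝓝[>] 0) (𝓝 (0 * K)) :=
      (tendsto_id.mul_const K).mono_left nhdsWithin_le_nhds
    rw [zero_mul] at this
    exact this.mono_left hl
  have h01 : ∀ᶠ t in l, t ∈ Set.Ioo (0 : ℝ) 1 := hl (Ioo_mem_nhdsGT one_pos)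
  refine squeeze_zero_norm' ?_ ht0
  filter_upwards [hf, hF, h01] with t h1 h2 h3
  -- On the curve with `t ≠ 0` the factor `t ^ s` cancels; what remains is the trailing coefficient
  -- plus `t` times a function bounded on the unit square.
  rw [← aevalAeval_swap, hG, map_mul, map_pow, aevalAeval_Y] at h2
  have h4 := (mul_eq_zero.1 h2).resolve_left (pow_ne_zero _ h3.1.ne')
  rw [← divX_mul_X_add G, map_add, map_mul, aevalAeval_Y, aevalAeval_C, hG0] at h4
  have h5 := hK (f t, t) ⟨h1, h3.1.le, h3.2.le⟩
  rw [show aeval (f t) (swap F).trailingCoeff = -(aevalAeval (f t) t G.divX * t) by linarith,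
    norm_neg, norm_mul, Real.norm_of_nonneg h3.1.le, mul_comm]
  exact mul_le_mul_of_nonneg_left h5 h3.1.le

/-- A bounded continuous function on which a nonzero polynomial tends to zero converges. -/
theorem exists_tendsto_of_tendsto_aeval {φ : ℤ[X]} (hφ : φ ≠ 0) {f : ℝ → ℝ}
    (hc : ContinuousOn f (Set.Ioo 0 1)) (hf : ∀ t ∈ Set.Ioo (0 : ℝ) 1, f t ∈ Set.Icc 0 1)
    (h : Tendsto (fun t => aeval (f t) φ) (𝓝[>] 0) (𝓝 0)) :
    ∃ w, Tendsto f (𝓝[>] 0) (𝓝 w) := by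
  have h01 : ∀ᶠ t in 𝓝[>] (0 : ℝ), t ∈ Set.Ioo (0 : ℝ) 1 := Ioo_mem_nhdsGT one_pos
  have hroots : {c : ℝ | aeval c φ = 0}.Finite := by
    have : {c : ℝ | aeval c φ = 0} = (φ.map (Int.castRingHom ℝ)).rootSet ℝ := by
      ext c
      rw [mem_rootSet_of_ne ((Polynomial.map_ne_zero_iff Int.cast_injective).2 hφ)]
      exact Eq.congr_left (aeval_map_algebraMap ℝ c φ).symm
    rw [this]
    exact rootSet_finite _ _
  refine tendsto_of_no_upcrossings dense_univ ?_
    ⟨1, eventually_map.2 (h01.mono fun t ht => (hf t ht).2)⟩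
    ⟨0, eventually_map.2 (h01.mono fun t ht => (hf t ht).1)⟩
  rintro a - b - hab ⟨ha, hb⟩
  -- An oscillation across (a, b) would, by continuity, take the non-root value `c` arbitrarily
  -- close to the origin, whereas `φ` tends to zero along `f`.
  obtain ⟨c, ⟨hac, hcb⟩, hc0⟩ := (Set.Ioo_infinite hab).exists_notMem_finite hroots
  have hev : ∀ᶠ t in 𝓝[>] (0 : ℝ), f t ≠ c := by
    filter_upwards [h.eventually_ne (Ne.symm hc0)] with t ht hfc
    exact ht (by rw [hfc])
  obtain ⟨u, hu0, hu⟩ := mem_nhdsGT_iff_exists_Ioo_subset.1 (hev.and h01)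
  have hmem : ∀ᶠ t in 𝓝[>] (0 : ℝ), t ∈ Set.Ioo 0 u := Ioo_mem_nhdsGT hu0
  obtain ⟨s, hsa, hs⟩ := (ha.and_eventually hmem).exists
  obtain ⟨t, htb, ht⟩ := (hb.and_eventually hmem).exists
  have hsub : Set.uIcc s t ⊆ Set.Ioo 0 u := Set.OrdConnected.uIcc_subset Set.ordConnected_Ioo hs ht
  have hiv := intermediate_value_uIcc (hc.mono fun x hx => (hu (hsub hx)).2)
  obtain ⟨x, hx, hfx⟩ := hiv (show c ∈ Set.uIcc (f s) (f t) from
    Set.mem_uIcc.2 (Or.inl ⟨(hsa.trans hac).le, (hcb.trans htb).le⟩))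
  exact (hu (hsub hx)).1 hfx

/-- A bounded continuous function lying on finitely many plane algebraic curves converges at the
origin, to a root of the lowest coefficient of one of them. -/
theorem exists_tendsto_of_aevalAeval_eq_zero {ι : Type*} [Finite ι] (F : ι → ℤ[X][Y]) {f : ℝ → ℝ}
    (hc : ContinuousOn f (Set.Ioo 0 1)) (hf : ∀ t ∈ Set.Ioo (0 : ℝ) 1, f t ∈ Set.Icc 0 1)
    (hF : ∀ t ∈ Set.Ioo (0 : ℝ) 1, ∃ s, F s ≠ 0 ∧ aevalAeval t (f t) (F s) = 0) :
    ∃ w, Tendsto f (𝓝[>] 0) (𝓝 w) ∧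
      ∃ s, F s ≠ 0 ∧ aeval w (swap (F s)).trailingCoeff = 0 := by
  classical
  cases nonempty_fintype ι
  have h01 : ∀ᶠ t in 𝓝[>] (0 : ℝ), t ∈ Set.Ioo (0 : ℝ) 1 := Ioo_mem_nhdsGT one_pos
  -- The product serves only to prove convergence. For a good bound, the limit is then attached to a
  -- single factor, one that vanishes at points accumulating at 0.
  set P : ℤ[X][Y] := ∏ s ∈ Finset.univ.filter (fun s => F s ≠ 0), F s with hP
  have hP0 : P ≠ 0 := Finset.prod_ne_zero_iff.2 fun s hs => (Finset.mem_filter.1 hs).2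
  have hPf : ∀ t ∈ Set.Ioo (0 : ℝ) 1, aevalAeval t (f t) P = 0 := by
    intro t ht
    obtain ⟨s, hs, h0⟩ := hF t ht
    rw [hP, map_prod]
    exact Finset.prod_eq_zero (Finset.mem_filter.2 ⟨Finset.mem_univ s, hs⟩) h0
  have htr : ∀ Q : ℤ[X][Y], Q ≠ 0 → (swap Q).trailingCoeff ≠ 0 := fun Q hQ => by
    rw [Ne, trailingCoeff_eq_zero]
    simpa using hQ
  obtain ⟨w, hw⟩ := exists_tendsto_of_tendsto_aeval (htr P hP0) hc hf
    (tendsto_aeval_trailingCoeff_swap le_rfl (h01.mono hf) (h01.mono hPf))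
  refine ⟨w, hw, ?_⟩
  obtain ⟨s, hs⟩ : ∃ s, ∃ᶠ t in 𝓝[>] (0 : ℝ), F s ≠ 0 ∧ aevalAeval t (f t) (F s) = 0 := by
    by_contra! hcon
    obtain ⟨t, ht, ht'⟩ := (h01.and (eventually_all.2 hcon)).exists
    obtain ⟨s, hs⟩ := hF t ht
    exact ht' s hs.1 hs.2
  obtain ⟨t, ht⟩ := hs.exists
  refine ⟨s, ht.1, ?_⟩
  set l := 𝓝[>] (0 : ℝ) ⊓ 𝓟 {t | F s ≠ 0 ∧ aevalAeval t (f t) (F s) = 0} with hl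
  have : l.NeBot := frequently_mem_iff_neBot.1 hs
  have h1 := tendsto_aeval_trailingCoeff_swap (F := F s) (f := f) (l := l) inf_le_left
    ((h01.mono hf).filter_mono inf_le_left)
    (mem_inf_of_right (mem_principal.2 fun t ht => ht.2))
  have h2 : Tendsto (fun t => aeval (f t) (swap (F s)).trailingCoeff) l
      (𝓝 (aeval w (swap (F s)).trailingCoeff)) :=
    ((Polynomial.continuous_aeval _).tendsto w).comp (hw.mono_left inf_le_left)
  exact tendsto_nhds_unique h2 h1

end Bivariate

/-! ### Expectations under finite probabilities -/

section PMFExpectation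

variable {α β : Type*} [Fintype α] [Fintype β]

theorem PMF.sum_toReal_eq_one (p : PMF α) : ∑ a, (p a).toReal = 1 := by
  rw [← ENNReal.toReal_sum fun a _ => p.apply_ne_top a, ← tsum_fintype (L := .unconditional _),
    p.tsum_coe, ENNReal.toReal_one]

theorem PMF.toReal_mem_stdSimplex (p : PMF α) : (fun a => (p a).toReal) ∈ stdSimplex ℝ α :=
  ⟨fun _ => ENNReal.toReal_nonneg, p.sum_toReal_eq_one⟩

theorem PMF.sum_bind_toReal_mul (p : PMF α) (g : α → PMF β) (f : β → ℝ) :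
    ∑ b, (p.bind g b).toReal * f b = ∑ a, (p a).toReal * ∑ b, (g a b).toReal * f b := by
  have h : ∀ b, (p.bind g b).toReal = ∑ a, (p a).toReal * (g a b).toReal := fun b => by
    rw [PMF.bind_apply, tsum_fintype, ENNReal.toReal_sum]
    · simp only [ENNReal.toReal_mul]
    · exact fun a _ => ENNReal.mul_ne_top (p.apply_ne_top a) ((g a).apply_ne_top b)
  simp only [h, Finset.sum_mul, Finset.mul_sum]
  rw [Finset.sum_comm]
  exact Finset.sum_congr rfl fun a _ => Finset.sum_congr rfl fun b _ => mul_assoc _ _ _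

theorem PMF.sum_pure_toReal_mul (b : β) (f : β → ℝ) :
    ∑ b', (PMF.pure b b').toReal * f b' = f b := by
  classical
  rw [Finset.sum_eq_single b]
  · simp
  · intro b' _ hb; simp [PMF.pure_apply, hb]
  · simp

theorem PMF.sum_map_toReal_mul (p : PMF α) (g : α → β) (f : β → ℝ) :
    ∑ b, (p.map g b).toReal * f b = ∑ a, (p a).toReal * f (g a) := by
  rw [PMF.map, PMF.sum_bind_toReal_mul]
  exact Finset.sum_congr rfl fun a _ => by rw [Function.comp_apply, PMF.sum_pure_toReal_mul]

/-- The probability with given weights. -/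
noncomputable def PMF.ofStdSimplex (x : α → ℝ) (hx : x ∈ stdSimplex ℝ α) : PMF α :=
  PMF.ofFintype (fun a => ENNReal.ofReal (x a)) (by
    rw [← ENNReal.ofReal_sum_of_nonneg fun a _ => hx.1 a, hx.2, ENNReal.ofReal_one])

theorem PMF.ofStdSimplex_toReal {x : α → ℝ} (hx : x ∈ stdSimplex ℝ α) (a : α) :
    (PMF.ofStdSimplex x hx a).toReal = x a := by
  rw [PMF.ofStdSimplex, PMF.ofFintype_apply, ENNReal.toReal_ofReal (hx.1 a)]

end PMFExpectation

/-! ### Expectations along the play and the discounted payoff -/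

namespace StochasticGame

variable {n : ℕ} {I J : Fin n → Type*}

theorem measurable_comp_eval (f : Obs I J → ℝ) (m : ℕ) :
    Measurable fun z : ℕ → Obs I J => f (z m) :=
  (Measurable.of_discrete (f := f)).comp (measurable_pi_apply m)

theorem exists_bound_obs [∀ ℓ, Finite (I ℓ)] [∀ ℓ, Finite (J ℓ)] (f : Obs I J → ℝ) :
    ∃ B, 0 ≤ B ∧ ∀ z, ‖f z‖ ≤ B := by
  obtain ⟨B, hB⟩ := (Set.finite_range fun z => ‖f z‖).bddAbove
  exact ⟨max B 0, le_max_right _ _, fun z => (hB ⟨z, rfl⟩).trans (le_max_left _ _)⟩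

variable [∀ ℓ, Fintype (I ℓ)] [∀ ℓ, Fintype (J ℓ)]

theorem integral_obsLaw (p : PMF (Fin n)) (x : (ℓ : Fin n) → PMF (I ℓ))
    (y : (ℓ : Fin n) → PMF (J ℓ)) (f : Obs I J → ℝ) :
    ∫ z, f z ∂(obsLaw p x y).toMeasure =
      ∑ ℓ, (p ℓ).toReal * ∑ i, (x ℓ i).toReal * ∑ j, (y ℓ j).toReal * f ⟨ℓ, i, j⟩ := by
  classical
  let _ : Fintype (Obs I J) := Fintype.ofFinite _
  rw [PMF.integral_eq_sum]
  simp only [smul_eq_mul]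
  rw [obsLaw, PMF.sum_bind_toReal_mul]
  refine Finset.sum_congr rfl fun ℓ _ => ?_
  rw [PMF.sum_bind_toReal_mul]
  congr 1
  refine Finset.sum_congr rfl fun i _ => ?_
  exact congrArg _ (PMF.sum_map_toReal_mul (β := Obs I J) _ _ _)

variable (G : StochasticGame n I J) (k : Fin n) (σ : Strategy I J I) (τ : Strategy I J J)

instance : IsProbabilityMeasure (G.playLaw k σ τ) := by
  unfold playLaw
  have : IsProbabilityMeasure (obsLaw (PMF.pure k) (σ 0 Fin.elim0) (τ 0 Fin.elim0)).toMeasure :=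
    PMF.toMeasure.isProbabilityMeasure _
  infer_instance

theorem integrable_comp_eval (f : Obs I J → ℝ) (m : ℕ) :
    Integrable (fun z => f (z m)) (G.playLaw k σ τ) := by
  obtain ⟨B, -, hB⟩ := exists_bound_obs f
  exact Integrable.of_bound (measurable_comp_eval f m).aestronglyMeasurable B
    (Eventually.of_forall fun z => hB _)

theorem map_eval_zero_playLaw :
    (G.playLaw k σ τ).map (fun z => z 0) =
      (obsLaw (PMF.pure k) (σ 0 Fin.elim0) (τ 0 Fin.elim0)).toMeasure := by
  set μ₀ := (obsLaw (PMF.pure k) (σ 0 Fin.elim0) (τ 0 Fin.elim0)).toMeasure with hμ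
  have h1 : (G.playLaw k σ τ).map (Preorder.frestrictLe (π := fun _ => Obs I J) 0) =
      μ₀.map (MeasurableEquiv.piUnique (fun _ : Finset.Iic 0 => Obs I J)).symm := by
    rw [playLaw, Kernel.trajMeasure, Measure.map_comp _ _ (by fun_prop),
      Kernel.traj_map_frestrictLe, Kernel.partialTraj_self, Measure.id_comp]
  have h2 : (fun z : ℕ → Obs I J => z 0) =
      (MeasurableEquiv.piUnique (fun _ : Finset.Iic 0 => Obs I J)) ∘
        (Preorder.frestrictLe (π := fun _ => Obs I J) 0) := by
    ext z; rfl
  rw [h2, ← Measure.map_map (by fun_prop) (by fun_prop), h1, Measure.map_map (by fun_prop)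
    (by fun_prop)]
  convert Measure.map_id
  ext z
  simp

theorem integral_eval_zero (f : Obs I J → ℝ) :
    ∫ z, f (z 0) ∂(G.playLaw k σ τ) =
      ∑ i, (σ 0 Fin.elim0 k i).toReal * ∑ j, (τ 0 Fin.elim0 k j).toReal * f ⟨k, i, j⟩ := by
  rw [← integral_map (φ := fun z : ℕ → Obs I J => z 0) (f := f)
    (measurable_pi_apply 0).aemeasurable Measurable.of_discrete.aestronglyMeasurable,
    map_eval_zero_playLaw, integral_obsLaw, PMF.sum_pure_toReal_mul]

/-- Tower property: the joint law of the history and the next observation is the composition-product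
of the history's law with the step kernel. -/
theorem integral_eval_succ (f : Obs I J → ℝ) (m : ℕ) :
    ∫ z, f (z (m + 1)) ∂(G.playLaw k σ τ) =
      ∫ z, (∫ w, f w ∂(G.stepKernel σ τ m (Preorder.frestrictLe m z))) ∂(G.playLaw k σ τ) := by
  obtain ⟨B, -, hB⟩ := exists_bound_obs f
  have : IsProbabilityMeasure (obsLaw (PMF.pure k) (σ 0 Fin.elim0) (τ 0 Fin.elim0)).toMeasure :=
    PMF.toMeasure.isProbabilityMeasure _
  have hmap := Kernel.map_frestrictLe_trajMeasure_compProd_eq_map_trajMeasure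
    (X := fun _ => Obs I J)
    (μ₀ := (obsLaw (PMF.pure k) (σ 0 Fin.elim0) (τ 0 Fin.elim0)).toMeasure)
    (κ := G.stepKernel σ τ) (a := m)
  have hf : Measurable fun p : ((_ : Finset.Iic m) → Obs I J) × Obs I J => f p.2 :=
    (Measurable.of_discrete (f := f)).comp measurable_snd
  have h1 : ∫ p, f p.2 ∂((G.playLaw k σ τ).map
      (fun z => (Preorder.frestrictLe (π := fun _ => Obs I J) m z, z (m + 1)))) =
      ∫ z, f (z (m + 1)) ∂(G.playLaw k σ τ) :=
    integral_map (by fun_prop) hf.aestronglyMeasurable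
  rw [← h1, playLaw, ← hmap, Measure.integral_compProd, integral_map (by fun_prop)]
  · exact Measurable.of_discrete.aestronglyMeasurable
  · have : IsProbabilityMeasure ((Kernel.trajMeasure (X := fun _ => Obs I J)
      (obsLaw (PMF.pure k) (σ 0 Fin.elim0) (τ 0 Fin.elim0)).toMeasure
      (G.stepKernel σ τ)).map (Preorder.frestrictLe m)) :=
      Measure.isProbabilityMeasure_map (by fun_prop)
    exact Integrable.of_bound hf.aestronglyMeasurable B (Eventually.of_forall fun z => hB _)

/-- The expectation of a function of the `m`-th observation is nonnegative if its expectation is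
nonnegative for every mixed actions prescribed by the strategies. -/
theorem integral_eval_nonneg (f : Obs I J → ℝ)
    (h : ∀ m past ℓ, 0 ≤ ∑ i, (σ m past ℓ i).toReal * ∑ j, (τ m past ℓ j).toReal * f ⟨ℓ, i, j⟩)
    (m : ℕ) : 0 ≤ ∫ z, f (z m) ∂(G.playLaw k σ τ) := by
  rcases m with _ | m
  · rw [integral_eval_zero]
    exact h 0 _ k
  · rw [integral_eval_succ]
    refine integral_nonneg fun z => ?_
    change 0 ≤ ∫ w, f w ∂(obsLaw _ _ _).toMeasure
    rw [integral_obsLaw]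
    exact Finset.sum_nonneg fun ℓ _ => mul_nonneg ENNReal.toReal_nonneg (h _ _ ℓ)

/-- The expectation of `v` after the transition. -/
def nextValue (v : Fin n → ℝ) (z : Obs I J) : ℝ :=
  ∑ ℓ, (G.q z.1 z.2.1 z.2.2 ℓ).toReal * v ℓ

theorem integral_eval_succ_fst (v : Fin n → ℝ) (m : ℕ) :
    ∫ z, v (z (m + 1)).1 ∂(G.playLaw k σ τ) =
      ∫ z, G.nextValue v (z m) ∂(G.playLaw k σ τ) := by
  rw [G.integral_eval_succ k σ τ (fun w => v w.1)]
  refine integral_congr_ae (Eventually.of_forall fun z => ?_)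
  change ∫ w, v w.1 ∂(obsLaw _ _ _).toMeasure = _
  rw [integral_obsLaw]
  simp only [← Finset.sum_mul, PMF.sum_toReal_eq_one, one_mul]
  rfl

theorem integral_eval_zero_fst (v : Fin n → ℝ) :
    ∫ z, v (z 0).1 ∂(G.playLaw k σ τ) = v k := by
  rw [G.integral_eval_zero k σ τ (fun w => v w.1)]
  simp only [← Finset.sum_mul, PMF.sum_toReal_eq_one, one_mul]

theorem hasSum_payoff {lam : ℝ} (h0 : 0 < lam) (h1 : lam ≤ 1) :
    HasSum (fun m => lam * (1 - lam) ^ m *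
      ∫ z, G.g (z m).1 (z m).2.1 (z m).2.2 ∂(G.playLaw k σ τ)) (G.payoff lam k σ τ) := by
  set f : Obs I J → ℝ := fun z => G.g z.1 z.2.1 z.2.2 with hf
  obtain ⟨B, hB0, hB⟩ := exists_bound_obs f
  have hgeo : Summable fun m : ℕ => lam * (1 - lam) ^ m * B :=
    ((summable_geometric_of_lt_one (by linarith) (by linarith)).mul_left lam).mul_right B
  have := hasSum_integral_of_summable_integral_norm (μ := G.playLaw k σ τ)
    (F := fun (m : ℕ) (z : ℕ → Obs I J) => lam * (1 - lam) ^ m * f (z m))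
    (fun m => (G.integrable_comp_eval k σ τ f m).const_mul _) (by
      refine Summable.of_nonneg_of_le (fun m => integral_nonneg fun z => norm_nonneg _)
        (fun m => ?_) hgeo
      have hc : 0 ≤ lam * (1 - lam) ^ m := mul_nonneg h0.le (pow_nonneg (by linarith) m)
      calc ∫ z, ‖lam * (1 - lam) ^ m * f (z m)‖ ∂(G.playLaw k σ τ)
          ≤ ∫ _, lam * (1 - lam) ^ m * B ∂(G.playLaw k σ τ) := by
            refine integral_mono ((G.integrable_comp_eval k σ τ f m).const_mul _).norm
              (integrable_const _) fun z => ?_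
            simp only [norm_mul]
            rw [← norm_mul, Real.norm_of_nonneg hc]
            exact mul_le_mul_of_nonneg_left (hB _) hc
        _ = _ := by simp)
  simp only [integral_const_mul] at this
  exact this

/-- The gap between the payoff and `v k` is the discounted sum of the expected gaps in the Shapley
equation. -/
theorem hasSum_payoff_sub {lam : ℝ} (h0 : 0 < lam) (h1 : lam ≤ 1)
    (v : Fin n → ℝ) :
    HasSum (fun m => (1 - lam) ^ m * ∫ z, (lam * G.g (z m).1 (z m).2.1 (z m).2.2 +
      (1 - lam) * G.nextValue v (z m) - v (z m).1) ∂(G.playLaw k σ τ))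
      (G.payoff lam k σ τ - v k) := by
  set U : ℕ → ℝ := fun m => ∫ z, v (z m).1 ∂(G.playLaw k σ τ) with hU
  have hint : ∀ m, ∫ z, (lam * G.g (z m).1 (z m).2.1 (z m).2.2 +
      (1 - lam) * G.nextValue v (z m) - v (z m).1) ∂(G.playLaw k σ τ) =
      lam * ∫ z, G.g (z m).1 (z m).2.1 (z m).2.2 ∂(G.playLaw k σ τ) +
        (1 - lam) * U (m + 1) - U m := by
    intro m
    have i1 := (G.integrable_comp_eval k σ τ (fun z => G.g z.1 z.2.1 z.2.2) m).const_mul lam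
    have i2 := (G.integrable_comp_eval k σ τ (G.nextValue v) m).const_mul (1 - lam)
    have i3 := G.integrable_comp_eval k σ τ (fun z => v z.1) m
    refine (integral_sub (i1.add i2) i3).trans (congrArg (· - U m) ?_)
    refine (integral_add i1 i2).trans ?_
    rw [integral_const_mul, integral_const_mul, hU]
    simp only
    rw [integral_eval_succ_fst]
  obtain ⟨B, hB0, hB⟩ := exists_bound_obs (fun z : Obs I J => v z.1)
  have hUB : ∀ m, ‖U m‖ ≤ B := fun m => by
    have := norm_integral_le_of_norm_le_const (μ := G.playLaw k σ τ)
      (f := fun z => v (z m).1) (C := B) (Eventually.of_forall fun z => hB (z m))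
    simpa using this
  have hs : Summable fun m => (1 - lam) ^ m * U m := by
    refine Summable.of_norm_bounded
      ((summable_geometric_of_lt_one (r := 1 - lam) (by linarith) (by linarith)).mul_right B)
      fun m => ?_
    rw [norm_mul, Real.norm_of_nonneg (pow_nonneg (by linarith) m)]
    exact mul_le_mul_of_nonneg_left (hUB m) (pow_nonneg (by linarith) m)
  -- The shifted series minus the original one telescopes to `-U 0`, that is `-v k`.
  have hs1 := (hasSum_nat_add_iff' 1).2 hs.hasSum
  have hU0 : U 0 = v k := G.integral_eval_zero_fst k σ τ v
  have hfin := ((G.hasSum_payoff k σ τ h0 h1).add hs1).sub hs.hasSum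
  simp only [Finset.sum_range_one, pow_zero, one_mul, hU0] at hfin
  rw [show G.payoff lam k σ τ + (∑' m, (1 - lam) ^ m * U m - v k) - ∑' m, (1 - lam) ^ m * U m =
    G.payoff lam k σ τ - v k by ring] at hfin
  refine Eq.subst (motive := fun F : ℕ → ℝ => HasSum F _) (funext fun m => ?_) hfin
  rw [hint]
  ring

theorem payoff_mem_Icc {lam : ℝ} (h0 : 0 < lam) (h1 : lam ≤ 1)
    (hg : ∀ ℓ i j, G.g ℓ i j ∈ Set.Icc 0 1) :
    G.payoff lam k σ τ ∈ Set.Icc 0 1 := by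
  have hs := G.hasSum_payoff k σ τ h0 h1
  have hc : ∀ m : ℕ, 0 ≤ lam * (1 - lam) ^ m := fun m =>
    mul_nonneg h0.le (pow_nonneg (by linarith) m)
  refine ⟨hs.nonneg fun m => mul_nonneg (hc m) (integral_nonneg fun z => (hg _ _ _).1), ?_⟩
  have hgeo := (hasSum_geometric_of_lt_one (r := 1 - lam) (by linarith) (by linarith)).mul_left lam
  rw [sub_sub_cancel, mul_inv_cancel₀ h0.ne'] at hgeo
  refine hasSum_le (fun m => ?_) hs hgeo
  refine mul_le_of_le_one_right (hc m) ?_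
  calc ∫ z, G.g (z m).1 (z m).2.1 (z m).2.2 ∂(G.playLaw k σ τ)
      ≤ ∫ _, (1 : ℝ) ∂(G.playLaw k σ τ) :=
        integral_mono (G.integrable_comp_eval k σ τ (fun z => G.g z.1 z.2.1 z.2.2) m)
          (integrable_const _) fun z => (hg _ _ _).2
    _ = 1 := by simp

end StochasticGame

/-! ### The Shapley equation -/

namespace StochasticGame

open Matrix

variable {n : ℕ} {I J : Fin n → Type*}

/-- The local game at state `ℓ` when the continuation payoffs are `u`. -/
def shapleyMatrix (G : StochasticGame n I J) (lam : ℝ) (u : Fin n → ℝ) (ℓ : Fin n) :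
    Matrix (I ℓ) (J ℓ) ℝ :=
  of fun i j => lam * G.g ℓ i j + (1 - lam) * ∑ ℓ', (G.q ℓ i j ℓ').toReal * u ℓ'

theorem shapleyMatrix_apply (G : StochasticGame n I J) (lam : ℝ) (u : Fin n → ℝ) (ℓ : Fin n)
    (i : I ℓ) (j : J ℓ) : G.shapleyMatrix lam u ℓ i j =
      lam * G.g ℓ i j + (1 - lam) * ∑ ℓ', (G.q ℓ i j ℓ').toReal * u ℓ' := rfl

theorem nextValue_mk [∀ ℓ, Fintype (I ℓ)] [∀ ℓ, Fintype (J ℓ)] (G : StochasticGame n I J)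
    (v : Fin n → ℝ) (ℓ : Fin n) (i : I ℓ) (j : J ℓ) :
    G.nextValue v ⟨ℓ, i, j⟩ = ∑ ℓ', (G.q ℓ i j ℓ').toReal * v ℓ' := rfl

theorem _root_.PMF.sum_toReal_mul_le_add {α : Type*} [Fintype α] (p : PMF α) {u u' : α → ℝ} {d : ℝ}
    (h : ∀ a, u a ≤ u' a + d) :
    ∑ a, (p a).toReal * u a ≤ ∑ a, (p a).toReal * u' a + d := by
  calc ∑ a, (p a).toReal * u a ≤ ∑ a, (p a).toReal * (u' a + d) :=
        Finset.sum_le_sum fun a _ => mul_le_mul_of_nonneg_left (h a) ENNReal.toReal_nonneg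
    _ = _ := by
        simp only [mul_add, Finset.sum_add_distrib, ← Finset.sum_mul, p.sum_toReal_eq_one, one_mul]

theorem shapleyMatrix_le_add (G : StochasticGame n I J) {lam : ℝ} (h1 : lam ≤ 1) {u u' : Fin n → ℝ}
    {d : ℝ} (h : ∀ ℓ, u ℓ ≤ u' ℓ + d) (ℓ : Fin n) (i : I ℓ) (j : J ℓ) :
    G.shapleyMatrix lam u ℓ i j ≤ G.shapleyMatrix lam u' ℓ i j + (1 - lam) * d := by
  rw [shapleyMatrix_apply, shapleyMatrix_apply]
  have := mul_le_mul_of_nonneg_left ((G.q ℓ i j).sum_toReal_mul_le_add h) (sub_nonneg.2 h1)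
  linarith

variable [∀ ℓ, Fintype (I ℓ)] [∀ ℓ, Fintype (J ℓ)]

/-- `v` solves the Shapley equation, with optimal stationary strategies `x` and `y`. -/
def IsShapleySolution (G : StochasticGame n I J) (lam : ℝ) (v : Fin n → ℝ)
    (x : (ℓ : Fin n) → I ℓ → ℝ) (y : (ℓ : Fin n) → J ℓ → ℝ) : Prop :=
  ∀ ℓ, IsMatrixValue (G.shapleyMatrix lam v ℓ) (v ℓ) (x ℓ) (y ℓ)

/-- By comparison of matrix games, the operator sending continuation payoffs to local values
contracts the sup distance by 1 - λ; the solution is its fixed point. -/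
theorem exists_isShapleySolution [∀ ℓ, Nonempty (I ℓ)] [∀ ℓ, Nonempty (J ℓ)]
    (G : StochasticGame n I J) {lam : ℝ} (h0 : 0 < lam) (h1 : lam ≤ 1) :
    ∃ v x y, G.IsShapleySolution lam v x y := by
  choose T x y hT using fun (u : Fin n → ℝ) (ℓ : Fin n) =>
    exists_isMatrixValue (G.shapleyMatrix lam u ℓ)
  have hle : ∀ u u' ℓ, T u ℓ ≤ T u' ℓ + (1 - lam) * dist u u' := fun u u' ℓ =>
    (hT u ℓ).le_add (hT u' ℓ) (G.shapleyMatrix_le_add h1 (fun ℓ => by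
      have := (le_abs_self _).trans (dist_le_pi_dist u u' ℓ)
      linarith) ℓ)
  have hcoe : (Real.toNNReal (1 - lam) : ℝ) = 1 - lam := Real.coe_toNNReal _ (sub_nonneg.2 h1)
  have hc : ContractingWith (Real.toNNReal (1 - lam)) T := by
    refine ⟨by rw [← NNReal.coe_lt_coe, hcoe, NNReal.coe_one]; linarith,
       LipschitzWith.of_dist_le_mul fun u u' => ?_⟩
    rw [hcoe]
    refine (dist_pi_le_iff (mul_nonneg (sub_nonneg.2 h1) dist_nonneg)).2 fun ℓ => ?_
    rw [Real.dist_eq, abs_sub_le_iff]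
    have e1 := hle u u' ℓ
    have e2 := hle u' u ℓ
    rw [dist_comm] at e2
    exact ⟨by linarith, by linarith⟩
  set v := ContractingWith.fixedPoint T hc with hv
  have hfix : T v = v := hc.fixedPoint_isFixedPt
  refine ⟨v, x v, y v, fun ℓ => ?_⟩
  have := hT v ℓ
  rwa [hfix] at this

/-- The stationary strategy which uses the mixed actions `x`. -/
noncomputable def stationary {A : Fin n → Type*} [∀ ℓ, Fintype (A ℓ)] (x : (ℓ : Fin n) → A ℓ → ℝ)
    (hx : ∀ ℓ, x ℓ ∈ stdSimplex ℝ (A ℓ)) : Strategy I J A :=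
  fun _ _ ℓ => PMF.ofStdSimplex (x ℓ) (hx ℓ)

variable {G : StochasticGame n I J} {lam : ℝ} {v : Fin n → ℝ} {x : (ℓ : Fin n) → I ℓ → ℝ}
  {y : (ℓ : Fin n) → J ℓ → ℝ}

/-- Against any mixed action after any history, the local optimality of `x` makes the expected
Shapley gap nonnegative; the discounted gaps sum to payoff minus `v k`. -/
theorem IsShapleySolution.le_payoff (h : G.IsShapleySolution lam v x y) (h0 : 0 < lam)
    (h1 : lam ≤ 1) (k : Fin n) (τ : Strategy I J J) :
    v k ≤ G.payoff lam k (stationary x fun ℓ => (h ℓ).left_mem) τ := by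
  rw [← sub_nonneg]
  refine (G.hasSum_payoff_sub k _ τ h0 h1 v).nonneg fun m => mul_nonneg
    (pow_nonneg (by linarith) m) (G.integral_eval_nonneg k _ τ (fun z => lam * G.g z.1 z.2.1 z.2.2 +
      (1 - lam) * G.nextValue v z - v z.1) (fun m past ℓ => ?_) m)
  simp only [stationary, PMF.ofStdSimplex_toReal]
  have hval := le_sum_mul_of_mem_stdSimplex (τ m past ℓ).toReal_mem_stdSimplex (h ℓ).le_left
  simp only [vecMul, dotProduct, Finset.sum_mul] at hval
  rw [Finset.sum_comm] at hval
  have e1 : ∑ i, x ℓ i * ∑ j, (τ m past ℓ j).toReal * v ℓ = v ℓ := by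
    simp only [← Finset.sum_mul, PMF.sum_toReal_eq_one, one_mul, (h ℓ).left_mem.2]
  have e2 : ∑ i, x ℓ i * ∑ j, (τ m past ℓ j).toReal * (lam * G.g ℓ i j +
      (1 - lam) * G.nextValue v ⟨ℓ, i, j⟩ - v ℓ) =
      ∑ i, ∑ j, x ℓ i * G.shapleyMatrix lam v ℓ i j * (τ m past ℓ j).toReal - v ℓ := by
    conv_rhs => rw [← e1]
    rw [← Finset.sum_sub_distrib]
    refine Finset.sum_congr rfl fun i _ => ?_
    rw [Finset.mul_sum, Finset.mul_sum, ← Finset.sum_sub_distrib]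
    refine Finset.sum_congr rfl fun j _ => ?_
    rw [shapleyMatrix_apply, nextValue_mk]
    ring
  rw [e2]
  linarith

theorem IsShapleySolution.payoff_le (h : G.IsShapleySolution lam v x y) (h0 : 0 < lam)
    (h1 : lam ≤ 1) (k : Fin n) (σ : Strategy I J I) :
    G.payoff lam k σ (stationary y fun ℓ => (h ℓ).right_mem) ≤ v k := by
  rw [← sub_nonpos]
  refine hasSum_le (fun m => ?_) (G.hasSum_payoff_sub k σ _ h0 h1 v) hasSum_zero
  refine mul_nonpos_of_nonneg_of_nonpos (pow_nonneg (by linarith) m) ?_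
  rw [← neg_nonneg, ← integral_neg]
  refine G.integral_eval_nonneg k σ _ (fun z => -(lam * G.g z.1 z.2.1 z.2.2 +
      (1 - lam) * G.nextValue v z - v z.1)) (fun m past ℓ => ?_) m
  simp only [stationary, PMF.ofStdSimplex_toReal]
  have hval := sum_mul_le_of_mem_stdSimplex (σ m past ℓ).toReal_mem_stdSimplex (h ℓ).right_le
  simp only [mulVec, dotProduct, Finset.sum_mul] at hval
  have e1 : ∑ i, (σ m past ℓ i).toReal * ∑ j, y ℓ j * v ℓ = v ℓ := by
    simp only [← Finset.sum_mul, PMF.sum_toReal_eq_one, one_mul, (h ℓ).right_mem.2]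
  have e2 : ∑ i, (σ m past ℓ i).toReal * ∑ j, y ℓ j * -(lam * G.g ℓ i j +
      (1 - lam) * G.nextValue v ⟨ℓ, i, j⟩ - v ℓ) =
      v ℓ - ∑ i, ∑ j, G.shapleyMatrix lam v ℓ i j * y ℓ j * (σ m past ℓ i).toReal := by
    conv_rhs => rw [← e1]
    rw [← Finset.sum_sub_distrib]
    refine Finset.sum_congr rfl fun i _ => ?_
    rw [Finset.mul_sum, Finset.mul_sum, ← Finset.sum_sub_distrib]
    refine Finset.sum_congr rfl fun j _ => ?_
    rw [shapleyMatrix_apply, nextValue_mk]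
    ring
  rw [e2]
  linarith

theorem IsShapleySolution.value_eq (h : G.IsShapleySolution lam v x y) (h0 : 0 < lam)
    (h1 : lam ≤ 1) (hg : ∀ ℓ i j, G.g ℓ i j ∈ Set.Icc 0 1) (k : Fin n) :
    G.value lam k = v k := by
  -- Real suprema and infima of unbounded families take a default value, so boundedness of the
  -- payoff is essential here.
  have hbb : ∀ σ, BddBelow (Set.range fun τ => G.payoff lam k σ τ) := fun σ =>
    ⟨0, by rintro _ ⟨τ, rfl⟩; exact (G.payoff_mem_Icc k σ τ h0 h1 hg).1⟩
  have hτ : Nonempty (Strategy I J J) := ⟨stationary y fun ℓ => (h ℓ).right_mem⟩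
  have hσ : Nonempty (Strategy I J I) := ⟨stationary x fun ℓ => (h ℓ).left_mem⟩
  have hle : ∀ σ, ⨅ τ, G.payoff lam k σ τ ≤ v k := fun σ =>
    (ciInf_le (hbb σ) _).trans (h.payoff_le h0 h1 k σ)
  refine le_antisymm (ciSup_le hle) ?_
  refine le_trans ?_ (le_ciSup (f := fun σ => ⨅ τ, G.payoff lam k σ τ)
    ⟨v k, by rintro _ ⟨σ, rfl⟩; exact hle σ⟩ (stationary x fun ℓ => (h ℓ).left_mem))
  exact le_ciInf fun τ => h.le_payoff h0 h1 k τ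

theorem IsShapleySolution.mem_Icc (h : G.IsShapleySolution lam v x y) (h0 : 0 < lam)
    (h1 : lam ≤ 1) (hg : ∀ ℓ i j, G.g ℓ i j ∈ Set.Icc 0 1) (k : Fin n) : v k ∈ Set.Icc 0 1 :=
  ⟨(G.payoff_mem_Icc k _ _ h0 h1 hg).1.trans
      (h.payoff_le h0 h1 k (stationary x fun ℓ => (h ℓ).left_mem)),
    (h.le_payoff h0 h1 k (stationary y fun ℓ => (h ℓ).right_mem)).trans
      (G.payoff_mem_Icc k _ _ h0 h1 hg).2⟩

/-- At a state with the largest gap δ between `v` and `v'`, changing the discount factor costs at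
most |λ - μ| and changing the continuation at most (1 - μ)δ. So μδ ≤ |λ - μ|. -/
theorem IsShapleySolution.le_add (h : G.IsShapleySolution lam v x y) (h0 : 0 < lam)
    (h1 : lam ≤ 1) (hg : ∀ ℓ i j, G.g ℓ i j ∈ Set.Icc 0 1) {mu : ℝ} {v' : Fin n → ℝ}
    {x' : (ℓ : Fin n) → I ℓ → ℝ} {y' : (ℓ : Fin n) → J ℓ → ℝ}
    (h' : G.IsShapleySolution mu v' x' y') (h0' : 0 < mu) (h1' : mu ≤ 1) (k : Fin n) :
    v k ≤ v' k + |lam - mu| / mu := by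
  obtain ⟨ℓ, -, hℓ⟩ := Finset.exists_max_image Finset.univ (fun ℓ => v ℓ - v' ℓ)
    ⟨k, Finset.mem_univ k⟩
  have hmax : ∀ k, v k ≤ v' k + (v ℓ - v' ℓ) := fun k => by
    linarith [hℓ k (Finset.mem_univ k)]
  have hv := (h ℓ).le_add (h' ℓ) (d := |lam - mu| + (1 - mu) * (v ℓ - v' ℓ)) fun i j => by
    have e1 := G.shapleyMatrix_le_add h1' hmax ℓ i j
    have e2 : G.shapleyMatrix lam v ℓ i j ≤ G.shapleyMatrix mu v ℓ i j + |lam - mu| := by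
      rw [shapleyMatrix_apply, shapleyMatrix_apply]
      have hq1 := (G.q ℓ i j).sum_toReal_mul_le_add (u := v) (u' := fun _ => 0) (d := 1)
        fun a => by linarith [(h.mem_Icc h0 h1 hg a).2]
      have hq0 : 0 ≤ ∑ a, (G.q ℓ i j a).toReal * v a := Finset.sum_nonneg fun a _ =>
        mul_nonneg ENNReal.toReal_nonneg (h.mem_Icc h0 h1 hg a).1
      simp only [mul_zero, Finset.sum_const_zero, zero_add] at hq1
      have hd : |G.g ℓ i j - ∑ a, (G.q ℓ i j a).toReal * v a| ≤ 1 := by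
        have := hg ℓ i j
        rw [abs_le]
        constructor <;> linarith [this.1, this.2]
      have := (le_abs_self _).trans (abs_mul (lam - mu)
        (G.g ℓ i j - ∑ a, (G.q ℓ i j a).toReal * v a)).le
      have := mul_le_mul_of_nonneg_left hd (abs_nonneg (lam - mu))
      linarith
    linarith
  have hmu : v ℓ - v' ℓ ≤ |lam - mu| / mu := by
    rw [le_div_iff₀ h0']
    linarith
  linarith [hmax k]

theorem continuousOn_value [∀ ℓ, Nonempty (I ℓ)] [∀ ℓ, Nonempty (J ℓ)]
    (G : StochasticGame n I J) (hg : ∀ ℓ i j, G.g ℓ i j ∈ Set.Icc 0 1) (k : Fin n) :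
    ContinuousOn (fun lam => G.value lam k) (Set.Ioo 0 1) := by
  intro mu hmu
  obtain ⟨v', x', y', h'⟩ := G.exists_isShapleySolution hmu.1 hmu.2.le
  rw [ContinuousWithinAt, tendsto_iff_dist_tendsto_zero]
  have hlim : Tendsto (fun lam : ℝ => |lam - mu| / mu + |mu - lam| / lam)
      (𝓝[Set.Ioo 0 1] mu) (𝓝 0) := by
    have : ContinuousAt (fun lam : ℝ => |lam - mu| / mu + |mu - lam| / lam) mu := by
      have := hmu.1.ne'
      fun_prop (disch := assumption)
    have h2 := this.tendsto
    simp only [sub_self, abs_zero, zero_div, add_zero] at h2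
    exact h2.mono_left nhdsWithin_le_nhds
  refine squeeze_zero' (Eventually.of_forall fun _ => dist_nonneg) ?_ hlim
  filter_upwards [self_mem_nhdsWithin] with lam hlam
  obtain ⟨v, x, y, h⟩ := G.exists_isShapleySolution hlam.1 hlam.2.le
  rw [h.value_eq hlam.1 hlam.2.le hg, h'.value_eq hmu.1 hmu.2.le hg, Real.dist_eq,
    abs_sub_le_iff]
  have e1 := h.le_add hlam.1 hlam.2.le hg h' hmu.1 hmu.2.le k
  have e2 := h'.le_add hmu.1 hmu.2.le hg h hlam.1 hlam.2.le k
  have := div_nonneg (abs_nonneg (lam - mu)) hmu.1.le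
  have := div_nonneg (abs_nonneg (mu - lam)) hlam.1.le
  constructor <;> linarith

end StochasticGame

/-! ### Stochastic matrices and multilinearity of determinants -/

section StochasticMatrix

open Matrix

variable {κ : Type*} [Fintype κ] [DecidableEq κ]

/-- Minimum principle: at a minimiser `b` of `w`, the average of `w` under row `b` is at least `w
b`, whence (1 - t) w b ≥ 0. -/
theorem Matrix.nonneg_of_one_sub_smul_mulVec_nonneg {Q : Matrix κ κ ℝ} (hQ0 : ∀ a b, 0 ≤ Q a b)
    (hQ1 : ∀ a, ∑ b, Q a b = 1) {t : ℝ} (ht0 : 0 ≤ t) (ht1 : t < 1) {w : κ → ℝ}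
    (hw : 0 ≤ (1 - t • Q) *ᵥ w) : 0 ≤ w := by
  intro a
  obtain ⟨b, -, hb⟩ := Finset.exists_min_image Finset.univ w ⟨a, Finset.mem_univ a⟩
  refine le_trans ?_ (hb a (Finset.mem_univ a))
  have h1 := hw b
  rw [sub_mulVec, one_mulVec, smul_mulVec] at h1
  simp only [Pi.zero_apply, Pi.sub_apply, Pi.smul_apply, smul_eq_mul, mulVec, dotProduct] at h1
  have h2 : w b ≤ ∑ c, Q b c * w c := by
    calc w b = ∑ c, Q b c * w b := by rw [← Finset.sum_mul, hQ1, one_mul]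
      _ ≤ _ := Finset.sum_le_sum fun c _ =>
        mul_le_mul_of_nonneg_left (hb c (Finset.mem_univ c)) (hQ0 b c)
  have h3 := mul_le_mul_of_nonneg_left h2 ht0
  have h4 : 0 ≤ (1 - t) * w b := by linarith
  exact nonneg_of_mul_nonneg_right h4 (by linarith)

/-- The minimum principle applied to ±w excludes null vectors along the segment from 0 to `t`, so
the determinant keeps its sign at 0. -/
theorem Matrix.det_one_sub_smul_pos {Q : Matrix κ κ ℝ} (hQ0 : ∀ a b, 0 ≤ Q a b)
    (hQ1 : ∀ a, ∑ b, Q a b = 1) {t : ℝ} (ht0 : 0 ≤ t) (ht1 : t < 1) :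
    0 < (1 - t • Q).det := by
  have hne : ∀ s ∈ Set.Icc 0 t, (1 - s • Q).det ≠ 0 := by
    intro s hs h0
    obtain ⟨w, hw0, hw⟩ := exists_mulVec_eq_zero_iff.2 h0
    have h1 := nonneg_of_one_sub_smul_mulVec_nonneg hQ0 hQ1 hs.1 (hs.2.trans_lt ht1) hw.ge
    have h2 := nonneg_of_one_sub_smul_mulVec_nonneg hQ0 hQ1 hs.1 (hs.2.trans_lt ht1)
      (w := -w) (by rw [mulVec_neg, hw, neg_zero])
    exact hw0 (le_antisymm (neg_nonneg.1 h2) h1)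
  by_contra hneg
  have hcont : Continuous fun s : ℝ => (1 - s • Q).det :=
    Continuous.matrix_det (by fun_prop)
  have := intermediate_value_Icc' ht0 hcont.continuousOn
    (show (0 : ℝ) ∈ Set.Icc ((1 - t • Q).det) ((1 - (0 : ℝ) • Q).det) from
      ⟨not_lt.1 hneg, by simp⟩)
  obtain ⟨s, hs, hs0⟩ := this
  exact hne s hs hs0

theorem Matrix.cramer_one_sub_smul_nonneg {Q : Matrix κ κ ℝ} (hQ0 : ∀ a b, 0 ≤ Q a b)
    (hQ1 : ∀ a, ∑ b, Q a b = 1) {t : ℝ} (ht0 : 0 ≤ t) (ht1 : t < 1) {b : κ → ℝ} (hb : 0 ≤ b) :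
    0 ≤ cramer (1 - t • Q) b := by
  refine nonneg_of_one_sub_smul_mulVec_nonneg hQ0 hQ1 ht0 ht1 ?_
  rw [mulVec_cramer]
  exact smul_nonneg (det_one_sub_smul_pos hQ0 hQ1 ht0 ht1).le hb

/-- Multilinearity in the rows: since row `ℓ` depends only on the action at `ℓ`, averaging
determinants over pure profiles with product weights amounts to averaging each row. -/
theorem Matrix.det_of_sum_smul {R : Type*} [CommRing R] {A : κ → Type*} [∀ ℓ, Fintype (A ℓ)]
    (x : (ℓ : κ) → A ℓ → R) (r : (ℓ : κ) → A ℓ → κ → R) :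
    (of fun ℓ => ∑ a, x ℓ a • r ℓ a).det =
      ∑ a : (ℓ : κ) → A ℓ, (∏ ℓ, x ℓ (a ℓ)) * (of fun ℓ => r ℓ (a ℓ)).det := by
  have h := (detRowAlternating (n := κ) (R := R)).toMultilinearMap.map_sum
    (fun ℓ a => x ℓ a • r ℓ a)
  refine h.trans (Finset.sum_congr rfl fun a _ => ?_)
  exact (detRowAlternating (n := κ) (R := R)).toMultilinearMap.map_smul_univ _ _

variable {A : κ → Type*} [∀ ℓ, Fintype (A ℓ)]

theorem sum_prod_eq_one {x : (ℓ : κ) → A ℓ → ℝ} (hx : ∀ ℓ, ∑ a, x ℓ a = 1) :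
    ∑ a : (ℓ : κ) → A ℓ, ∏ ℓ, x ℓ (a ℓ) = 1 := by
  rw [← Fintype.piFinset_univ, ← Finset.prod_univ_sum]
  simp [hx]

theorem Matrix.sum_prod_mul_det_one_sub_smul {x : (ℓ : κ) → A ℓ → ℝ} (hx : ∀ ℓ, ∑ a, x ℓ a = 1)
    (q : (ℓ : κ) → A ℓ → κ → ℝ) (t : ℝ) :
    ∑ a : (ℓ : κ) → A ℓ, (∏ ℓ, x ℓ (a ℓ)) * (1 - t • of fun ℓ => q ℓ (a ℓ)).det =
      (1 - t • of fun ℓ b => ∑ a, x ℓ a * q ℓ a b).det := by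
  have h := det_of_sum_smul x fun ℓ a b => (1 : Matrix κ κ ℝ) ℓ b - t * q ℓ a b
  refine Eq.trans (Finset.sum_congr rfl fun a _ => ?_) (h.symm.trans ?_)
  · congr 2
  · congr 1
    ext ℓ b
    simp only [of_apply, Finset.sum_apply, Pi.smul_apply, smul_eq_mul, sub_apply, smul_apply,
      mul_sub, Finset.sum_sub_distrib, ← Finset.sum_mul, hx, one_mul, Finset.mul_sum]
    congr 1
    exact Finset.sum_congr rfl fun a _ => by ring

theorem Matrix.sum_prod_mul_cramer_one_sub_smul {x : (ℓ : κ) → A ℓ → ℝ}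
    (hx : ∀ ℓ, ∑ a, x ℓ a = 1) (q : (ℓ : κ) → A ℓ → κ → ℝ) (g : (ℓ : κ) → A ℓ → ℝ) (t : ℝ) (k : κ) :
    ∑ a : (ℓ : κ) → A ℓ, (∏ ℓ, x ℓ (a ℓ)) *
        cramer (1 - t • of fun ℓ => q ℓ (a ℓ)) (fun ℓ => g ℓ (a ℓ)) k =
      cramer (1 - t • of fun ℓ b => ∑ a, x ℓ a * q ℓ a b) (fun ℓ => ∑ a, x ℓ a * g ℓ a) k := by
  simp only [cramer_apply]
  have h := det_of_sum_smul x fun ℓ a b =>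
    if b = k then g ℓ a else (1 : Matrix κ κ ℝ) ℓ b - t * q ℓ a b
  refine Eq.trans (Finset.sum_congr rfl fun a _ => ?_) (h.symm.trans ?_)
  · congr 2
    ext ℓ b
    simp [updateCol_apply]
  · congr 1
    ext ℓ b
    simp only [of_apply, Finset.sum_apply, Pi.smul_apply, smul_eq_mul, updateCol_apply, sub_apply,
      smul_apply]
    split_ifs
    · rfl
    · simp only [mul_sub, Finset.sum_sub_distrib, ← Finset.sum_mul, hx, one_mul, Finset.mul_sum]
      congr 1
      exact Finset.sum_congr rfl fun a _ => by ring

/-- The excess of the averaged payoffs over `v k`, expressed by the excess in each state. -/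
theorem Matrix.sum_prod_mul_cramer_sub_mul_det {x : (ℓ : κ) → A ℓ → ℝ}
    (hx : ∀ ℓ, ∑ a, x ℓ a = 1) (q : (ℓ : κ) → A ℓ → κ → ℝ) (g : (ℓ : κ) → A ℓ → ℝ) (t : ℝ) (k : κ)
    (v : κ → ℝ) :
    ∑ a : (ℓ : κ) → A ℓ, (∏ ℓ, x ℓ (a ℓ)) *
        (cramer (1 - t • of fun ℓ => q ℓ (a ℓ)) (fun ℓ => g ℓ (a ℓ)) k -
          v k * (1 - t • of fun ℓ => q ℓ (a ℓ)).det) =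
      cramer (1 - t • of fun ℓ b => ∑ a, x ℓ a * q ℓ a b)
        (fun ℓ => ∑ a, x ℓ a * (g ℓ a + t * ∑ b, q ℓ a b * v b) - v ℓ) k := by
  set M := 1 - t • of fun ℓ b => ∑ a, x ℓ a * q ℓ a b with hM
  have hb : (fun ℓ => ∑ a, x ℓ a * (g ℓ a + t * ∑ b, q ℓ a b * v b) - v ℓ) =
      (fun ℓ => ∑ a, x ℓ a * g ℓ a) - M *ᵥ v := by
    ext ℓ
    rw [hM, sub_mulVec, one_mulVec, smul_mulVec]
    simp only [Pi.sub_apply, Pi.smul_apply, smul_eq_mul, mulVec, dotProduct, of_apply, mul_add,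
      Finset.sum_add_distrib, Finset.sum_mul, Finset.mul_sum]
    rw [Finset.sum_comm]
    have : ∀ b a, x ℓ a * (t * (q ℓ a b * v b)) = t * (x ℓ a * q ℓ a b * v b) := fun b a => by ring
    simp only [this]
    ring
  -- This absorbs the term `v k * det` into the Cramer determinant, whose right-hand side becomes
  -- the statewise excess.
  have hcr : cramer M (M *ᵥ v) k = v k * M.det := by
    rw [cramer_eq_adjugate_mulVec, mulVec_mulVec, adjugate_mul, smul_mulVec, one_mulVec]
    simp [mul_comm]
  rw [hb, map_sub, Pi.sub_apply, hcr, ← sum_prod_mul_cramer_one_sub_smul hx,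
    ← sum_prod_mul_det_one_sub_smul hx, Finset.mul_sum, ← Finset.sum_sub_distrib]
  exact Finset.sum_congr rfl fun a _ => by ring

end StochasticMatrix

/-! ### The matrix game on pure stationary strategies -/

namespace StochasticGame

open Matrix

variable {n : ℕ} {I J : Fin n → Type*} (G : StochasticGame n I J)

/-- The transition matrix of a pure stationary profile. -/
def transitionMatrix (i : (ℓ : Fin n) → I ℓ) (j : (ℓ : Fin n) → J ℓ) :
    Matrix (Fin n) (Fin n) ℝ :=
  of fun ℓ ℓ' => (G.q ℓ (i ℓ) (j ℓ) ℓ').toReal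

/-- The matrix of the numerators of the discounted payoffs of pure stationary profiles. -/
noncomputable def numMatrix (lam : ℝ) (k : Fin n) :
    Matrix ((ℓ : Fin n) → I ℓ) ((ℓ : Fin n) → J ℓ) ℝ :=
  of fun i j => cramer (1 - (1 - lam) • G.transitionMatrix i j)
    (fun ℓ => lam * G.g ℓ (i ℓ) (j ℓ)) k

/-- The matrix of the denominators of the discounted payoffs of pure stationary profiles. -/
noncomputable def denMatrix (lam : ℝ) : Matrix ((ℓ : Fin n) → I ℓ) ((ℓ : Fin n) → J ℓ) ℝ :=
  of fun i j => (1 - (1 - lam) • G.transitionMatrix i j).det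

theorem denMatrix_pos {lam : ℝ} (h0 : 0 < lam) (h1 : lam ≤ 1) (i : (ℓ : Fin n) → I ℓ)
    (j : (ℓ : Fin n) → J ℓ) : 0 < G.denMatrix lam i j :=
  det_one_sub_smul_pos (fun _ _ => ENNReal.toReal_nonneg) (fun _ => PMF.sum_toReal_eq_one _)
    (by linarith) (by linarith)

variable [∀ ℓ, Fintype (I ℓ)] [∀ ℓ, Fintype (J ℓ)]
variable {G} {lam : ℝ} {v : Fin n → ℝ} {x : (ℓ : Fin n) → I ℓ → ℝ} {y : (ℓ : Fin n) → J ℓ → ℝ}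

theorem sum_mul_toReal_nonneg_and_sum_eq_one {α : Type*} [Fintype α] {x : α → ℝ}
    (hx : x ∈ stdSimplex ℝ α) (q : α → PMF (Fin n)) :
    (∀ b, 0 ≤ ∑ a, x a * (q a b).toReal) ∧ ∑ b, ∑ a, x a * (q a b).toReal = 1 := by
  refine ⟨fun b => Finset.sum_nonneg fun a _ => mul_nonneg (hx.1 a) ENNReal.toReal_nonneg, ?_⟩
  rw [Finset.sum_comm]
  simp only [← Finset.mul_sum, PMF.sum_toReal_eq_one, mul_one, hx.2]

/-- The witness is the product of the local optimal mixed actions. Against a pure `j`, the averaged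
entry is the Cramer solution for the local excesses, which are nonnegative. -/
theorem IsShapleySolution.exists_nonneg_vecMul (h : G.IsShapleySolution lam v x y) (h0 : 0 < lam)
    (h1 : lam ≤ 1) (k : Fin n) : ∃ X : ((ℓ : Fin n) → I ℓ) → ℝ, 0 ≤ X ∧ X ≠ 0 ∧
      0 ≤ X ᵥ* (G.numMatrix lam k - v k • G.denMatrix lam) := by
  refine ⟨fun a => ∏ ℓ, x ℓ (a ℓ), fun a => Finset.prod_nonneg fun ℓ _ => (h ℓ).left_mem.1 _,
    fun hX => ?_, fun j => ?_⟩
  · have := sum_prod_eq_one fun ℓ => (h ℓ).left_mem.2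
    simp only [show ∀ a : (ℓ : Fin n) → I ℓ, ∏ ℓ, x ℓ (a ℓ) = 0 from congrFun hX] at this
    simp at this
  · have key := sum_prod_mul_cramer_sub_mul_det (fun ℓ => (h ℓ).left_mem.2)
      (fun ℓ a b => (G.q ℓ a (j ℓ) b).toReal) (fun ℓ a => lam * G.g ℓ a (j ℓ)) (1 - lam) k v
    refine le_of_le_of_eq ?_ key.symm
    refine cramer_one_sub_smul_nonneg
      (fun ℓ => (sum_mul_toReal_nonneg_and_sum_eq_one (h ℓ).left_mem fun a => G.q ℓ a (j ℓ)).1)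
      (fun ℓ => (sum_mul_toReal_nonneg_and_sum_eq_one (h ℓ).left_mem fun a => G.q ℓ a (j ℓ)).2)
      (by linarith) (by linarith) (fun ℓ => sub_nonneg.2 ((h ℓ).le_left (j ℓ))) k

theorem IsShapleySolution.exists_mulVec_nonpos (h : G.IsShapleySolution lam v x y) (h0 : 0 < lam)
    (h1 : lam ≤ 1) (k : Fin n) : ∃ Y : ((ℓ : Fin n) → J ℓ) → ℝ, 0 ≤ Y ∧ Y ≠ 0 ∧
      (G.numMatrix lam k - v k • G.denMatrix lam) *ᵥ Y ≤ 0 := by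
  refine ⟨fun a => ∏ ℓ, y ℓ (a ℓ), fun a => Finset.prod_nonneg fun ℓ _ => (h ℓ).right_mem.1 _,
    fun hX => ?_, fun i => ?_⟩
  · have := sum_prod_eq_one fun ℓ => (h ℓ).right_mem.2
    simp only [show ∀ a : (ℓ : Fin n) → J ℓ, ∏ ℓ, y ℓ (a ℓ) = 0 from congrFun hX] at this
    simp at this
  · have key := sum_prod_mul_cramer_sub_mul_det (fun ℓ => (h ℓ).right_mem.2)
      (fun ℓ a b => (G.q ℓ (i ℓ) a b).toReal) (fun ℓ a => lam * G.g ℓ (i ℓ) a) (1 - lam) k v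
    have e : ((G.numMatrix lam k - v k • G.denMatrix lam) *ᵥ fun a => ∏ ℓ, y ℓ (a ℓ)) i = _ :=
      (Finset.sum_congr rfl fun a _ => mul_comm _ _).trans key
    rw [e, Pi.zero_apply, ← neg_nonneg, ← Pi.neg_apply, ← map_neg]
    refine cramer_one_sub_smul_nonneg
      (fun ℓ => (sum_mul_toReal_nonneg_and_sum_eq_one (h ℓ).right_mem fun a => G.q ℓ (i ℓ) a).1)
      (fun ℓ => (sum_mul_toReal_nonneg_and_sum_eq_one (h ℓ).right_mem fun a => G.q ℓ (i ℓ) a).2)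
      (by linarith) (by linarith) (fun ℓ => ?_) k
    have := (h ℓ).right_le (i ℓ)
    simp only [mulVec, dotProduct, mul_comm _ (y ℓ _)] at this
    exact neg_nonneg.2 (sub_nonpos.2 this)

/-- The discounted value is a root of a nonzero polynomial `det (A' - z B')`, for some square
submatrices of the matrices of numerators and of denominators. -/
theorem IsShapleySolution.exists_submatrix_det_eq_zero (h : G.IsShapleySolution lam v x y)
    (h0 : 0 < lam) (h1 : lam ≤ 1) (k : Fin n) :
    ∃ (m : ℕ) (r : Fin m → (ℓ : Fin n) → I ℓ) (c : Fin m → (ℓ : Fin n) → J ℓ),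
      ((G.numMatrix lam k - v k • G.denMatrix lam).submatrix r c).det = 0 ∧
      ∃ z : ℝ, ((G.numMatrix lam k - z • G.denMatrix lam).submatrix r c).det ≠ 0 :=
  Matrix.exists_submatrix_det_eq_zero _ _ _ (G.denMatrix_pos h0 h1)
    (h.exists_nonneg_vecMul h0 h1 k) (h.exists_mulVec_nonpos h0 h1 k)

end StochasticGame

/-! ### Integer polynomials for the determinants, and their lengths -/

section IntegerPolynomials

open Matrix

theorem prod_univ_le_pow {ι : Type*} [Fintype ι] {f : ι → ℝ} {K : ℝ} (h0 : ∀ i, 0 ≤ f i)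
    (h : ∀ i, f i ≤ K) : ∏ i, f i ≤ K ^ Fintype.card ι :=
  (Finset.prod_le_prod (fun i _ => h0 i) fun i _ => h i).trans (by simp)

variable {κ : Type*} [DecidableEq κ]

/-- `N (1 - (1 - X) Q)` where `Q = β / N`. -/
noncomputable def polyMatrix (N : ℕ) (β : κ → κ → ℕ) : Matrix κ κ ℤ[X] :=
  of fun a b => C (if a = b then (N : ℤ) else 0) - (1 - X) * C (β a b : ℤ)

theorem polyMatrix_map_aeval {N : ℕ} (hN : 0 < N) (β : κ → κ → ℕ) (t : ℝ) :
    (polyMatrix N β).map (aeval t) =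
      (N : ℝ) • (1 - (1 - t) • of fun a b => (β a b : ℝ) / N) := by
  have hN' : (N : ℝ) ≠ 0 := by exact_mod_cast hN.ne'
  ext a b
  simp only [polyMatrix, map_apply, of_apply, map_sub, map_mul, aeval_X, map_one, Matrix.smul_apply,
    Matrix.sub_apply, smul_eq_mul, one_apply, mul_sub, eq_intCast]
  congr 1
  · split_ifs <;> simp
  · field_simp
    simp

theorem length_polyMatrix_apply_le (N : ℕ) (β : κ → κ → ℕ) (a b : κ) :
    (normRingSeminorm ℤ).length (polyMatrix N β a b) ≤
      (if a = b then (N : ℝ) else 0) + 2 * β a b := by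
  set ν := normRingSeminorm ℤ with hν
  have hC : ∀ c : ℤ, ν.length (C c) = |(c : ℝ)| := fun c => by
    rw [RingSeminorm.length_C]; exact Int.norm_eq_abs c
  have h1 : ν.length (1 - X) ≤ 2 := by
    refine (map_sub_le_add _ _ _).trans ?_
    rw [RingSeminorm.length_X, ← C_1, hC]
    have : ν 1 = 1 := norm_one (α := ℤ)
    rw [this]
    norm_num
  rw [polyMatrix, of_apply]
  refine (map_sub_le_add _ _ _).trans (add_le_add ?_ ?_)
  · rw [hC]
    split_ifs <;> simp
  · refine (map_mul_le_mul _ _ _).trans ?_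
    rw [hC]
    simp only [Int.cast_natCast, Nat.abs_cast]
    gcongr

variable [Fintype κ]

/-- The integer polynomial `N ^ n det (1 - (1 - X) Q)`. -/
noncomputable def polyDen (N : ℕ) (β : κ → κ → ℕ) : ℤ[X] := (polyMatrix N β).det

/-- The integer polynomial obtained by replacing column `k` by `X α`. -/
noncomputable def polyNum (N : ℕ) (β : κ → κ → ℕ) (α : κ → ℕ) (k : κ) : ℤ[X] :=
  cramer (polyMatrix N β) (fun a => X * C (α a : ℤ)) k

theorem aeval_polyDen {N : ℕ} (hN : 0 < N) (β : κ → κ → ℕ) (t : ℝ) :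
    aeval t (polyDen N β) =
      (N : ℝ) ^ Fintype.card κ * (1 - (1 - t) • of fun a b => (β a b : ℝ) / N).det := by
  rw [polyDen, AlgHom.map_det, AlgHom.mapMatrix_apply, polyMatrix_map_aeval hN, det_smul]

theorem aeval_polyNum {N : ℕ} (hN : 0 < N) (β : κ → κ → ℕ) (α : κ → ℕ) (k : κ) (t : ℝ) :
    aeval t (polyNum N β α k) = (N : ℝ) ^ Fintype.card κ *
      cramer (1 - (1 - t) • of fun a b => (β a b : ℝ) / N) (fun a => t * (α a / N)) k := by
  have hN' : (N : ℝ) ≠ 0 := by exact_mod_cast hN.ne'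
  rw [polyNum, cramer_apply, cramer_apply, AlgHom.map_det, AlgHom.mapMatrix_apply, ← det_smul]
  congr 1
  have h := polyMatrix_map_aeval hN β t
  ext a b
  have hab := congrFun (congrFun h a) b
  rw [map_apply] at hab
  rw [map_apply, Matrix.smul_apply, updateCol_apply, updateCol_apply]
  split_ifs
  · simp only [map_mul, aeval_X, eq_intCast, smul_eq_mul]
    field_simp
    simp
  · rw [hab, Matrix.smul_apply]

theorem length_one_le : (normRingSeminorm ℤ).length 1 ≤ 1 := by
  rw [← C_1, RingSeminorm.length_C]
  exact (norm_one (α := ℤ)).le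

theorem sum_length_polyMatrix_le {N : ℕ} {β : κ → κ → ℕ} (hβ : ∀ a, ∑ b, β a b = N) (a : κ) :
    ∑ b, (normRingSeminorm ℤ).length (polyMatrix N β a b) ≤ 3 * N := by
  refine (Finset.sum_le_sum fun b _ => length_polyMatrix_apply_le N β a b).trans ?_
  rw [Finset.sum_add_distrib, ← Finset.mul_sum, Finset.sum_ite_eq]
  have := hβ a
  have h2 : ∑ b, (β a b : ℝ) = N := by exact_mod_cast this
  rw [h2]
  simp only [Finset.mem_univ, if_true]
  linarith

/-- Each row has length at most 3N: N from the diagonal, 2N from `1 - X` times a row of sum N. The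
constant 4N is shared with `polyNum`, whose replaced column may add another N. -/
theorem length_polyDen_le {N : ℕ} {β : κ → κ → ℕ} (hβ : ∀ a, ∑ b, β a b = N) :
    (normRingSeminorm ℤ).length (polyDen N β) ≤ (4 * N : ℝ) ^ Fintype.card κ := by
  refine (RingSeminorm.map_det_le _ length_one_le _).trans ?_
  refine prod_univ_le_pow (fun a => Finset.sum_nonneg fun b _ => apply_nonneg _ _) fun a => ?_
  linarith [sum_length_polyMatrix_le hβ a, Nat.cast_nonneg (α := ℝ) N]

theorem length_polyNum_le {N : ℕ} {β : κ → κ → ℕ} (hβ : ∀ a, ∑ b, β a b = N) {α : κ → ℕ}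
    (hα : ∀ a, α a ≤ N) (k : κ) :
    (normRingSeminorm ℤ).length (polyNum N β α k) ≤ (4 * N : ℝ) ^ Fintype.card κ := by
  rw [polyNum, cramer_apply]
  refine (RingSeminorm.map_det_le _ length_one_le _).trans ?_
  refine prod_univ_le_pow (fun a => Finset.sum_nonneg fun b _ => apply_nonneg _ _) fun a => ?_
  have hle : ∀ b, (normRingSeminorm ℤ).length
      ((polyMatrix N β).updateCol k (fun a => X * C (α a : ℤ)) a b) ≤
      (normRingSeminorm ℤ).length (polyMatrix N β a b) + if b = k then (N : ℝ) else 0 := by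
    intro b
    rw [updateCol_apply]
    split_ifs
    · refine (map_mul_le_mul _ _ _).trans ?_
      rw [RingSeminorm.length_X, RingSeminorm.length_C]
      have e1 : normRingSeminorm ℤ 1 = 1 := norm_one (α := ℤ)
      have e2 : normRingSeminorm ℤ (α a : ℤ) = α a := Int.norm_natCast _
      have e3 : (α a : ℝ) ≤ N := by exact_mod_cast hα a
      rw [e1, e2, one_mul]
      linarith [apply_nonneg (normRingSeminorm ℤ).length (polyMatrix N β a b)]
    · simp
  refine (Finset.sum_le_sum fun b _ => hle b).trans ?_
  rw [Finset.sum_add_distrib, Finset.sum_ite_eq']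
  simp only [Finset.mem_univ, if_true]
  linarith [sum_length_polyMatrix_le hβ a]

/-- The bivariate polynomial `det (A - Y B)`. -/
noncomputable def pencilDet {m : ℕ} (A B : Matrix (Fin m) (Fin m) ℤ[X]) : ℤ[X][X] :=
  ((X : ℤ[X][X]) • (-B).map C + A.map C).det

theorem natDegree_pencilDet_le {m : ℕ} (A B : Matrix (Fin m) (Fin m) ℤ[X]) :
    (pencilDet A B).natDegree ≤ m :=
  (natDegree_det_X_add_C_le (-B) A).trans (Fintype.card_fin m).le

theorem aevalAeval_pencilDet {m : ℕ} (A B : Matrix (Fin m) (Fin m) ℤ[X]) (t z : ℝ) :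
    aevalAeval t z (pencilDet A B) = (A.map (aeval t) - z • B.map (aeval t)).det := by
  rw [pencilDet, AlgHom.map_det, AlgHom.mapMatrix_apply]
  congr 1
  ext i j
  simp only [map_apply, Matrix.add_apply, Matrix.smul_apply, smul_eq_mul, Matrix.neg_apply, map_add, map_mul, map_neg,
    aevalAeval_Y, aevalAeval_C, Matrix.sub_apply]
  ring

theorem length_pencilDet_le {m : ℕ} {A B : Matrix (Fin m) (Fin m) ℤ[X]} {K : ℝ}
    (hA : ∀ i j, (normRingSeminorm ℤ).length (A i j) ≤ K)
    (hB : ∀ i j, (normRingSeminorm ℤ).length (B i j) ≤ K) :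
    (normRingSeminorm ℤ).length.length (pencilDet A B) ≤ (m * (2 * K)) ^ m := by
  set ν := (normRingSeminorm ℤ).length with hν
  have h1 : ν.length 1 ≤ 1 := by
    rw [← C_1, RingSeminorm.length_C]
    exact length_one_le
  refine (RingSeminorm.map_det_le _ h1 _).trans ?_
  have : ∀ i, ∑ j, ν.length (((X : ℤ[X][X]) • (-B).map C + A.map C : Matrix _ _ _) i j)
      ≤ m * (2 * K) := fun i => by
    have hle : ∀ j ∈ Finset.univ,
        ν.length (((X : ℤ[X][X]) • (-B).map C + A.map C : Matrix _ _ _) i j) ≤ 2 * K := fun j _ => by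
      rw [Matrix.add_apply, Matrix.smul_apply, map_apply, map_apply, Matrix.neg_apply, smul_eq_mul]
      refine (map_add_le_add _ _ _).trans ?_
      have e1 := map_mul_le_mul ν.length X (C (-B i j))
      rw [RingSeminorm.length_X, RingSeminorm.length_C, map_neg_eq_map ν] at e1
      have e2 := mul_le_mul_of_nonneg_right (length_one_le) (apply_nonneg ν (B i j))
      rw [RingSeminorm.length_C]
      linarith [hA i j, hB i j]
    refine (Finset.sum_le_card_nsmul _ _ _ hle).trans ?_
    simp
  refine (prod_univ_le_pow (fun a => Finset.sum_nonneg fun b _ => apply_nonneg _ _) this).trans ?_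
  rw [Fintype.card_fin]

end IntegerPolynomials

/-! ### Numerical bound and conclusion -/

theorem bitSize_le_iff {a C : ℕ} : bitSize a ≤ C ↔ a < 2 ^ C := by
  have h : (0 : ℝ) < (a : ℝ) + 1 := by positivity
  rw [bitSize, Nat.ceil_le, Real.logb_le_iff_le_rpow (by norm_num) h, Real.rpow_natCast]
  constructor
  · intro h
    have : a + 1 ≤ 2 ^ C := by exact_mod_cast h
    omega
  · intro h
    have : a + 1 ≤ 2 ^ C := h
    exact_mod_cast this

/-- Writing `b` for `bitSize N`, the bounds m ≤ 2^d and 4N ≤ 2^(2+b) give the exponent 2d + d² + 2nd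
+ ndb, at most 6d²n²b; the constant 8 leaves room for strictness. -/
theorem coeff_bound_lt {m d n N : ℕ} (hm : m ≤ d) (hd : 1 ≤ d) (hn : 1 ≤ n) (hN : 1 ≤ N) :
    2 ^ m * (m * (2 * (4 * N) ^ n)) ^ m < 2 ^ (8 * d ^ 2 * n ^ 2 * bitSize N) := by
  set b := bitSize N with hb
  have hNb : N < 2 ^ b := bitSize_le_iff.1 le_rfl
  have hb1 : 1 ≤ b := by
    by_contra h
    have : b = 0 := by omega
    rw [this, pow_zero] at hNb
    omega
  have hm2 : m ≤ 2 ^ d := (hm.trans Nat.lt_two_pow_self.le)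
  obtain ⟨e, he⟩ : ∃ e, e = 2 + b := ⟨_, rfl⟩
  have h4 : 4 * N ≤ 2 ^ e := by
    rw [he, pow_add]
    omega
  calc 2 ^ m * (m * (2 * (4 * N) ^ n)) ^ m
      ≤ 2 ^ d * (2 ^ d * (2 * (2 ^ e) ^ n)) ^ m := by
        gcongr
        norm_num
    _ ≤ 2 ^ d * (2 ^ d * (2 * (2 ^ e) ^ n)) ^ d := by
        have : 0 < 2 ^ d * (2 * (2 ^ e) ^ n) := by positivity
        gcongr
    _ = 2 ^ (d + (d + (1 + e * n)) * d) := by ring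
    _ < 2 ^ (8 * d ^ 2 * n ^ 2 * b) := by
        apply Nat.pow_lt_pow_right (by norm_num)
        rw [he]
        have hdb : d ≤ d ^ 2 * n ^ 2 * b := by
          calc d = d * 1 * 1 * 1 := by ring
            _ ≤ d * d * n ^ 2 * b := by gcongr; exact Nat.one_le_pow _ _ hn
            _ = _ := by ring
        have hddb : d * d ≤ d ^ 2 * n ^ 2 * b := by
          calc d * d = d * d * 1 * 1 := by ring
            _ ≤ d * d * n ^ 2 * b := by gcongr; exact Nat.one_le_pow _ _ hn
            _ = _ := by ring
        have hnd : n * d * b ≤ d ^ 2 * n ^ 2 * b := by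
          calc n * d * b = (n * 1) * (d * 1) * b := by ring
            _ ≤ (n * n) * (d * d) * b := by gcongr
            _ = _ := by ring
        have hnd1 : n * d ≤ n * d * b := Nat.le_mul_of_pos_right _ hb1
        have hpos : 1 ≤ d ^ 2 * n ^ 2 * b := le_trans hd hdb
        nlinarith

namespace StochasticGame

open Matrix

variable {n : ℕ} {I J : Fin n → Type*}

theorem IsRationalWith.g_mem_Icc {G : StochasticGame n I J} {N : ℕ} (h : G.IsRationalWith N)
    (ℓ : Fin n) (i : I ℓ) (j : J ℓ) : G.g ℓ i j ∈ Set.Icc 0 1 := by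
  obtain ⟨m, hm, hg⟩ := (h.2 ℓ i j).1
  have hN : (0 : ℝ) < N := by exact_mod_cast h.1
  rw [hg]
  refine ⟨by positivity, ?_⟩
  rw [div_le_one hN]
  exact_mod_cast hm

end StochasticGame

theorem mainTheorem7 {n : ℕ} {I J : Fin n → Type*}
    [∀ ℓ, Fintype (I ℓ)] [∀ ℓ, Fintype (J ℓ)] [∀ ℓ, Nonempty (I ℓ)] [∀ ℓ, Nonempty (J ℓ)]
    (G : StochasticGame n I J) (N : ℕ) (hN : G.IsRationalWith N) (k : Fin n) :
    ∃ w : ℝ, Tendsto (fun lam : ℝ => G.value lam k) (𝓝[>] 0) (𝓝 w) ∧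
      (∃! P : ℤ[X], IsDefiningPolynomial P w) ∧
      ∀ P : ℤ[X], IsDefiningPolynomial P w →
        ∀ i : ℕ, bitSize (P.coeff i).natAbs
          ≤ 8 * Fintype.card ((ℓ : Fin n) → I ℓ) ^ 2 * n ^ 2 * bitSize N := by
  classical
  set d := Fintype.card ((ℓ : Fin n) → I ℓ) with hd
  have hN0 := hN.1
  have hN' : (N : ℝ) ≠ 0 := by exact_mod_cast hN0.ne'
  choose α hαN hα using fun ℓ i j => (hN.2 ℓ i j).1
  choose β hβN hβ using fun ℓ i j => (hN.2 ℓ i j).2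
  have hβ1 : ∀ ℓ i j, ∑ ℓ', β ℓ i j ℓ' = N := fun ℓ i j => by
    have h1 := (G.q ℓ i j).sum_toReal_eq_one
    simp only [hβ, ← Finset.sum_div] at h1
    rw [div_eq_one_iff_eq hN'] at h1
    exact_mod_cast h1
  let num : Matrix ((ℓ : Fin n) → I ℓ) ((ℓ : Fin n) → J ℓ) ℤ[X] := Matrix.of fun i j =>
    polyNum N (fun ℓ => β ℓ (i ℓ) (j ℓ)) (fun ℓ => α ℓ (i ℓ) (j ℓ)) k
  let den : Matrix ((ℓ : Fin n) → I ℓ) ((ℓ : Fin n) → J ℓ) ℤ[X] := Matrix.of fun i j =>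
    polyDen N (fun ℓ => β ℓ (i ℓ) (j ℓ))
  have htrans : ∀ i j, G.transitionMatrix i j =
      Matrix.of fun ℓ ℓ' => (β ℓ (i ℓ) (j ℓ) ℓ' : ℝ) / N := fun i j => by
    ext ℓ ℓ'; exact hβ _ _ _ _
  have hnum : ∀ t : ℝ, num.map (aeval t) = (N : ℝ) ^ n • G.numMatrix t k := fun t => by
    ext i j
    simp only [num, Matrix.map_apply, Matrix.of_apply, aeval_polyNum hN0, Fintype.card_fin, Matrix.smul_apply, StochasticGame.numMatrix,
      htrans, hα, smul_eq_mul]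
  have hden : ∀ t : ℝ, den.map (aeval t) = (N : ℝ) ^ n • G.denMatrix t := fun t => by
    ext i j
    simp only [den, Matrix.map_apply, Matrix.of_apply, aeval_polyDen hN0, Fintype.card_fin, Matrix.smul_apply, StochasticGame.denMatrix,
      htrans, smul_eq_mul]
  have hdet : ∀ {m : ℕ} (r : Fin m → (ℓ : Fin n) → I ℓ) (c : Fin m → (ℓ : Fin n) → J ℓ) (t z : ℝ),
      aevalAeval t z (pencilDet (num.submatrix r c) (den.submatrix r c)) =
        ((N : ℝ) ^ n) ^ m * ((G.numMatrix t k - z • G.denMatrix t).submatrix r c).det := by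
    intro m r c t z
    rw [aevalAeval_pencilDet, ← Matrix.submatrix_map, ← Matrix.submatrix_map, hnum, hden]
    have : (((N : ℝ) ^ n • G.numMatrix t k).submatrix r c -
        z • ((N : ℝ) ^ n • G.denMatrix t).submatrix r c) =
        (N : ℝ) ^ n • (G.numMatrix t k - z • G.denMatrix t).submatrix r c := by
      ext a b
      simp only [Matrix.sub_apply, Matrix.smul_apply, Matrix.submatrix_apply, smul_eq_mul]
      ring
    rw [this, Matrix.det_smul, Fintype.card_fin]
  -- The finite family ranges over all choices of rows and columns of size at most `d`, whichever
  -- one is selected at a given discount factor.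
  let F : (Σ m : Fin (d + 1), (Fin m → (ℓ : Fin n) → I ℓ) × (Fin m → (ℓ : Fin n) → J ℓ)) →
      ℤ[X][X] := fun s => pencilDet (num.submatrix s.2.1 s.2.2) (den.submatrix s.2.1 s.2.2)
  have hF : ∀ t ∈ Set.Ioo (0 : ℝ) 1, ∃ s, F s ≠ 0 ∧ aevalAeval t (G.value t k) (F s) = 0 := by
    intro t ht
    obtain ⟨v, x, y, h⟩ := G.exists_isShapleySolution ht.1 ht.2.le
    obtain ⟨m, r, c, h0, z, hz⟩ := h.exists_submatrix_det_eq_zero ht.1 ht.2.le k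
    -- A repeated row would make the determinant vanish for every `z`; hence the size is at most the
    -- number of pure stationary strategies of Player 1.
    have hr : Function.Injective r := by
      intro a b hab
      by_contra hne
      exact hz (Matrix.det_zero_of_row_eq hne (by ext l; simp [hab]))
    have hm : m ≤ d := by
      simpa only [Fintype.card_fin] using Fintype.card_le_of_injective r hr
    refine ⟨⟨⟨m, Nat.lt_succ_of_le hm⟩, r, c⟩, fun hF0 => ?_, ?_⟩
    · have := hdet r c t z
      change pencilDet (num.submatrix r c) (den.submatrix r c) = 0 at hF0
      rw [hF0, map_zero] at this
      exact mul_ne_zero (pow_ne_zero _ (pow_ne_zero _ hN')) hz this.symm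
    · change aevalAeval t (G.value t k) (pencilDet (num.submatrix r c) (den.submatrix r c)) = 0
      rw [hdet, h.value_eq ht.1 ht.2.le hN.g_mem_Icc, h0, mul_zero]
  obtain ⟨w, hw, s, hs0, hs⟩ := exists_tendsto_of_aevalAeval_eq_zero F
    (G.continuousOn_value hN.g_mem_Icc k) (fun t ht => by
      obtain ⟨v, x, y, h⟩ := G.exists_isShapleySolution ht.1 ht.2.le
      rw [h.value_eq ht.1 ht.2.le hN.g_mem_Icc]
      exact h.mem_Icc ht.1 ht.2.le hN.g_mem_Icc k) hF
  have hQ0 : (Bivariate.swap (F s)).trailingCoeff ≠ 0 := by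
    rw [Ne, trailingCoeff_eq_zero]
    simpa using hs0
  refine ⟨w, hw, existsUnique_isDefiningPolynomial hQ0 hs, fun P hP i => ?_⟩
  rw [bitSize_le_iff]
  have hms : (s.1 : ℕ) ≤ d := Nat.lt_succ_iff.1 s.1.2
  refine lt_of_le_of_lt ?_ (coeff_bound_lt hms Fintype.card_pos (Fin.pos k) hN0)
  have h1 := hP.abs_coeff_le hQ0 hs i
  have h2 : (normRingSeminorm ℤ).length (Bivariate.swap (F s)).trailingCoeff ≤
      (s.1 * (2 * (4 * N : ℝ) ^ n)) ^ (s.1 : ℕ) := by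
    refine (RingSeminorm.length_coeff_swap_le _ _ _).trans (length_pencilDet_le ?_ ?_)
    · intro a b
      have := length_polyNum_le (β := fun ℓ => β ℓ (s.2.1 a ℓ) (s.2.2 b ℓ))
        (fun ℓ => hβ1 _ _ _) (α := fun ℓ => α ℓ (s.2.1 a ℓ) (s.2.2 b ℓ)) (fun ℓ => hαN _ _ _) k
      rwa [Fintype.card_fin] at this
    · intro a b
      have := length_polyDen_le (β := fun ℓ => β ℓ (s.2.1 a ℓ) (s.2.2 b ℓ)) (fun ℓ => hβ1 _ _ _)
      rwa [Fintype.card_fin] at this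
  have h3 : (normRingSeminorm ℤ).length (Bivariate.swap (F s)).trailingCoeff =
      (Bivariate.swap (F s)).trailingCoeff.sum fun _ a => |(a : ℝ)| := by
    rw [RingSeminorm.length_apply]
    exact Finset.sum_congr rfl fun e _ => Int.norm_eq_abs _
  rw [← h3] at h1
  have hdeg : (Bivariate.swap (F s)).trailingCoeff.natDegree ≤ s.1 :=
    (Bivariate.natDegree_coeff_swap_le _ _).trans (natDegree_pencilDet_le _ _)
  -- The power of 2 bounds the binomial factor from Mahler's inequality; the other factor bounds the
  -- length of the lowest λ-coefficient.
  have h4 : |(P.coeff i : ℝ)| ≤ 2 ^ (s.1 : ℕ) * (s.1 * (2 * (4 * N : ℝ) ^ n)) ^ (s.1 : ℕ) := by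
    refine h1.trans (mul_le_mul (pow_le_pow_right₀ (by norm_num) hdeg) h2 (apply_nonneg _ _)
      (by positivity))
  have h5 : ((P.coeff i).natAbs : ℝ) = |(P.coeff i : ℝ)| := by
    rw [← Int.norm_eq_abs, Int.norm_eq_abs, Nat.cast_natAbs, Int.cast_abs]
  rw [← h5] at h4
  exact_mod_cast h4
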